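/- Let $n,m,p\ge 1$ be integers and let $0<\theta_1<\dots<\theta_p$ be real numbers. Let $f:\mathbb R^n\times(\mathbb R^n)^p\times\mathbb R^m\to\mathbb R^n$ be continuous, and locally Lipschitz in its first two arguments $(x,v)\in\mathbb R^n\times(\mathbb R^n)^p$, uniformly with respect to the last argument on every compact subset of $\mathbb R^m$. Consider the delay system $$\text{(TDS)}\qquad \dot x(t)=f\big(x(t),(x(t-\theta_k))_{1\le k\le p},u(t)\big)$$ and the ordinary differential equation $$\text{(ODE)}\qquad \dot z(t)=f\big(z(t),(v_k(t))_{1\le k\le p},u(t)\big).$$ The input space is $\mathcal U=L^\infty_{loc}((0,\infty),\mathbb R^m)$, where $L^\infty_{loc}$ means measurable and essentially bounded on bounded subsets. The state space $\mathcal X$ of (TDS) is either $\mathcal X^0=C^0([-\theta_p,0],\mathbb R^n)$ with the supremum norm, or $\mathcal X^\infty\simeq L^\infty((-\theta_p,0),\mathbb R^n)\times\mathbb R^n$. The latter is the space of measurable, essentially bounded functions on $[-\theta_p,0]$, two functions being identified if they agree almost everywhere and at $0$, with the norm $\max(\|x_0\|_{L^\infty},|x_0(0)|)$. The solution of (TDS)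 for $x_0\in\mathcal X$ and $u\in\mathcal U$ is continuous in $t\geq 0$ and absolutely continuous on compact intervals. It satisfies $x(0)=x_0(0)$ and satisfies the equation for almost every $t>0$, where $x(s)$ is read as $x_0(s)$ for almost every $s\in[-\theta_p,0]$. The space $\mathcal V$ of delay-inputs $v$ of (ODE) is either $\mathcal V^0=C^0(\mathbb R_+,(\mathbb R^n)^p)$ or $\mathcal V^\infty=L^\infty_{loc}(\mathbb R_+,(\mathbb R^n)^p)$, and solutions of (ODE) with $z(0)=z_0\in\mathbb R^n$ are understood in the same (Carathéodory) sense. (TDS) on $\mathcal X$ is *forward complete* (FC) if for all $x_0\in\mathcal X$ and $u\in\mathcal U$ the solution exists on $[0,+\infty)$. It is *BRS* (has bounded reachability sets) if it is FC and for every $r>0$ the set of all values $x(t)$ with $t\in[0,r]$, $\|x_0\|_{\mathcal X}\le r$, $\|u\|_{L^\infty}\le r$ is bounded. Likewise, (ODE) with delay-inputs in $\mathcal V$ is FC if for all $z_0\in\mathbb R^n$, $v\in\mathcal V$, $u\in\mathcal U$ the solution exists on $[0,+\infty)$. It is BRS if it is FC and for every $r>0$ the set of all values $z(t)$ with $t\in[0,r]$,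 $|z_0|\le r$, $\|v\|_{L^\infty}\le r$, $\|u\|_{L^\infty}\le r$ is bounded. The following statements are equivalent: (i) (TDS) on $\mathcal X^\infty$ is FC; (ii) (TDS) on $\mathcal X^\infty$ is BRS; (iii) (TDS) on $\mathcal X^0$ is BRS; (iv) (ODE) with $v\in\mathcal V^\infty$ is FC; (v) (ODE) with $v\in\mathcal V^\infty$ is BRS; (vi) (ODE) with $v\in\mathcal V^0$ is BRS. Moreover, the following two statements are equivalent to each other and are implied by (i)–(vi): (vii) (TDS) on $\mathcal X^0$ is FC; (viii) (ODE) with $v\in\mathcal V^0$ is FC. Finally, (vii) and (viii) do not imply (i)–(vi): for all $n,m,p\ge1$ and $0<\theta_1<\dots<\theta_p$ there is a continuous $f$, locally Lipschitz in $(x,v)$ uniformly with respect to the last argument on all of $\mathbb R^m$, for which (vii) and (viii) hold while (i)–(vi) all fail. -/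

import Mathlib

open MeasureTheory Set
open scoped ENNReal Topology

namespace DelaySystem

/-- The Euclidean space `ℝ^d`. -/
abbrev Vec (d : ℕ) : Type := EuclideanSpace ℝ (Fin d)

/-- The right-hand sides `f : ℝ^n × (ℝ^n)^p × ℝ^m → ℝ^n`. -/
abbrev Field (n m p : ℕ) : Type := Vec n × (Fin p → Vec n) × Vec m → Vec n

/-- `f (x, v, u)` is locally Lipschitz in `(x, v)`, uniformly with respect to `u ∈ W`. -/
def LocLipschitzUniformlyOn {n m p : ℕ} (f : Field n m p) (W : Set (Vec m)) : Prop :=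
  ∀ q : Vec n × (Fin p → Vec n), ∃ N ∈ 𝓝 q, ∃ L : NNReal, ∀ u ∈ W,
    LipschitzOnWith L (fun y : Vec n × (Fin p → Vec n) => f (y.1, y.2, u)) N

/-- The half-open interval `[0, T)`, where `T` may be `+∞`. -/
def timeInterval (T : EReal) : Set ℝ := {t | 0 ≤ t ∧ (t : EReal) < T}

/-- `x ∈ C⁰([0, T), ℝ^n)` is absolutely continuous on every compact subinterval of `[0, T)` and
satisfies `x' (t) = g t` for almost all `t ∈ (0, T)`. Only the values of `x` on `[0, T)` matter. -/
def HasAEDerivOn {n : ℕ} (T : EReal) (x g : ℝ → Vec n) : Prop :=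
  ContinuousOn x (timeInterval T) ∧
  (∀ a b : ℝ, 0 ≤ a → a ≤ b → (b : EReal) < T → AbsolutelyContinuousOnInterval x a b) ∧
  ∀ᵐ t : ℝ, 0 < t → (t : EReal) < T → HasDerivAt x (g t) t

/-! ### Function spaces

Elements of quotient spaces of measurable functions are given by representatives, defined on all
of `ℝ`; only their values on the indicated interval matter. -/

/-- `𝒰 = L^∞_loc((0, ∞), ℝ^m)`: measurable and essentially bounded on bounded sets. -/
def inputs (m : ℕ) : Set (ℝ → Vec m) :=
  {u | ∀ T : ℝ, MemLp u ∞ (volume.restrict (Ioo 0 T))}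

/-- The `L^∞` norm on `(0, ∞)` of an input. -/
noncomputable def inputNorm {F : Type*} [NormedAddCommGroup F] (u : ℝ → F) : ℝ≥0∞ :=
  eLpNorm u ∞ (volume.restrict (Ioi (0 : ℝ)))

/-- The largest delay; for `0 < θ₁ < ⋯ < θ_p` with `p ≥ 1` this is `θ_p`. -/
noncomputable def maxDelay {p : ℕ} (θ : Fin p → ℝ) : ℝ := ⨆ k, θ k

/-- `𝒳⁰ = C⁰([-θ_p, 0], ℝ^n)`. -/
def stateC0 (n : ℕ) {p : ℕ} (θ : Fin p → ℝ) : Set (ℝ → Vec n) :=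
  {x₀ | ContinuousOn x₀ (Icc (-maxDelay θ) 0)}

/-- The norm of `𝒳⁰`: the supremum norm on `[-θ_p, 0]`. -/
noncomputable def normC0 {n p : ℕ} (θ : Fin p → ℝ) (x₀ : ℝ → Vec n) : ℝ≥0∞ :=
  ⨆ s ∈ Icc (-maxDelay θ) 0, ‖x₀ s‖ₑ

/-- `𝒳^∞`: measurable, essentially bounded functions on `[-θ_p, 0]`, where two functions are
identified if they agree almost everywhere and at the point `0`
(`IsTDSSolution.congr_state` below shows that solutions respect this identification). -/
def stateLinf (n : ℕ) {p : ℕ} (θ : Fin p → ℝ) : Set (ℝ → Vec n) :=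
  {x₀ | MemLp x₀ ∞ (volume.restrict (Icc (-maxDelay θ) 0))}

/-- The norm of `𝒳^∞`: `max (‖x₀‖_{L^∞}, |x₀ 0|)`. -/
noncomputable def normLinf {n p : ℕ} (θ : Fin p → ℝ) (x₀ : ℝ → Vec n) : ℝ≥0∞ :=
  max (eLpNorm x₀ ∞ (volume.restrict (Icc (-maxDelay θ) 0))) ‖x₀ 0‖ₑ

/-- `𝒱⁰ = C⁰(ℝ₊, (ℝ^n)^p)`. -/
def delayInputsC0 (n p : ℕ) : Set (ℝ → Fin p → Vec n) :=
  {v | ContinuousOn v (Ici 0)}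

/-- `𝒱^∞ = L^∞_loc(ℝ₊, (ℝ^n)^p)`. -/
def delayInputsLinf (n p : ℕ) : Set (ℝ → Fin p → Vec n) :=
  {v | ∀ T : ℝ, MemLp v ∞ (volume.restrict (Icc 0 T))}

/-! ### The delay system -/

/-- The concatenation `x₀ ⋄ x` of an initial function and a trajectory. -/
noncomputable def concat {n : ℕ} (x₀ x : ℝ → Vec n) (s : ℝ) : Vec n :=
  if 0 < s then x s else x₀ s

/-- `x` is a solution over `[0, T)` of `x' (t) = f (x (t), (x (t - θ_k))_k, u (t))` initialized
at `x₀`. -/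
def IsTDSSolution {n m p : ℕ} (f : Field n m p) (θ : Fin p → ℝ) (T : EReal)
    (x₀ : ℝ → Vec n) (u : ℝ → Vec m) (x : ℝ → Vec n) : Prop :=
  x 0 = x₀ 0 ∧
  HasAEDerivOn T x (fun t => f (x t, fun k => concat x₀ x (t - θ k), u t))

/-- Forward completeness of the delay system with state space `X`. -/
def TDSForwardComplete {n m p : ℕ} (f : Field n m p) (θ : Fin p → ℝ)
    (X : Set (ℝ → Vec n)) : Prop :=
  ∀ x₀ ∈ X, ∀ u ∈ inputs m, ∃ x : ℝ → Vec n, IsTDSSolution f θ ⊤ x₀ u x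

/-- Bounded reachability sets of the delay system with state space `X` normed by `N`. -/
def TDSBoundedReach {n m p : ℕ} (f : Field n m p) (θ : Fin p → ℝ)
    (X : Set (ℝ → Vec n)) (N : (ℝ → Vec n) → ℝ≥0∞) : Prop :=
  TDSForwardComplete f θ X ∧
  ∀ r : ℝ, 0 < r → Bornology.IsBounded
    {ξ : Vec n | ∃ t ∈ Icc 0 r, ∃ x₀ ∈ X, ∃ u ∈ inputs m, ∃ x : ℝ → Vec n,
      N x₀ ≤ ENNReal.ofReal r ∧ inputNorm u ≤ ENNReal.ofReal r ∧
      IsTDSSolution f θ ⊤ x₀ u x ∧ ξ = x t}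

/-! ### The associated ordinary differential equation -/

/-- `z` is a solution over `[0, T)` of `z' (t) = f (z (t), v (t), u (t))` with `z (0) = z₀`. -/
def IsODESolution {n m p : ℕ} (f : Field n m p) (T : EReal)
    (z₀ : Vec n) (v : ℝ → Fin p → Vec n) (u : ℝ → Vec m) (z : ℝ → Vec n) : Prop :=
  z 0 = z₀ ∧ HasAEDerivOn T z (fun t => f (z t, v t, u t))

/-- Forward completeness of the ordinary differential equation with delay-inputs in `V`. -/
def ODEForwardComplete {n m p : ℕ} (f : Field n m p) (V : Set (ℝ → Fin p → Vec n)) : Prop :=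
  ∀ z₀ : Vec n, ∀ v ∈ V, ∀ u ∈ inputs m, ∃ z : ℝ → Vec n, IsODESolution f ⊤ z₀ v u z

/-- Bounded reachability sets of the ordinary differential equation with delay-inputs in `V`. -/
def ODEBoundedReach {n m p : ℕ} (f : Field n m p) (V : Set (ℝ → Fin p → Vec n)) : Prop :=
  ODEForwardComplete f V ∧
  ∀ r : ℝ, 0 < r → Bornology.IsBounded
    {ξ : Vec n | ∃ t ∈ Icc 0 r, ∃ z₀ : Vec n, ∃ v ∈ V, ∃ u ∈ inputs m, ∃ z : ℝ → Vec n,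
      ‖z₀‖ ≤ r ∧ inputNorm v ≤ ENNReal.ofReal r ∧ inputNorm u ≤ ENNReal.ofReal r ∧
      IsODESolution f ⊤ z₀ v u z ∧ ξ = z t}

/-- Solutions do not depend on the representative of the initial state in `𝒳^∞`. -/
theorem IsTDSSolution.congr_state {n m p : ℕ} {f : Field n m p} {θ : Fin p → ℝ} {T : EReal}
    {x₀ y₀ : ℝ → Vec n} {u : ℝ → Vec m} {x : ℝ → Vec n}
    (h : IsTDSSolution f θ T x₀ u x) (h0 : x₀ 0 = y₀ 0)
    (hae : ∀ᵐ s ∂volume.restrict (Icc (-maxDelay θ) 0), x₀ s = y₀ s) :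
    IsTDSSolution f θ T y₀ u x := by
  obtain ⟨hx, hc, ha, hd⟩ := h
  refine ⟨hx.trans h0, hc, ha, ?_⟩
  have hk : ∀ᵐ t : ℝ, ∀ k : Fin p, t - θ k ∈ Icc (-maxDelay θ) 0 →
      x₀ (t - θ k) = y₀ (t - θ k) := by
    rw [ae_all_iff]
    intro k
    exact (measurePreserving_sub_right volume (θ k)).quasiMeasurePreserving.ae
      ((ae_restrict_iff' measurableSet_Icc).1 hae)
  filter_upwards [hd, hk] with t ht hkt h1 h2
  have : (fun k => concat y₀ x (t - θ k)) = fun k => concat x₀ x (t - θ k) := by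
    funext k
    unfold concat
    split_ifs with hs
    · rfl
    · have hle : θ k ≤ maxDelay θ := le_ciSup (Set.finite_range θ).bddAbove k
      exact (hkt k ⟨by linarith, not_lt.1 hs⟩).symm
  simpa only [this] using ht h1 h2

end DelaySystem

/-! The delay system and the ordinary differential equation are compared on intervals shorter than
the delays. There the delayed values are known data, so solutions of the delay system are built step
by step from solutions of the equation driven by the past. Conversely, since the delays are positive
and distinct, an initial state can be built whose delayed values are any prescribed delay-input
during a short time `δ` (`interpolate`). Restarting every `δ` turns completeness or bounded
reachability of the delay system into the same property of the equation.

The remaining analysis concerns the equation with the combined measurable input `w = (v, u)`.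
Forward completeness gives bounded reachability by contradiction (`not_unboundedNear`). If
trajectories starting near a point are unbounded in bounded time, their first hitting points on a
larger sphere accumulate at a point with the same property and less time left, up to an arbitrarily
small error. Iterating and concatenating inputs produces a single bounded input and points of norm
at least `k`, reached at times bounded independently of `k` from initial points in one ball. The
global trajectory from a cluster point of these initial points contradicts continuous dependence.
Concatenation creates jumps, which is why measurable delay-inputs are needed.

Bounded reachability passes from continuous to measurable delay-inputs by averaging
(`ODEBoundedReach.exists_isTraj_le`): the averages converge almost everywhere, obey the same bound,
and Grönwall's inequality passes to the limit.

For the counterexample, `x' = x ^ 2 * tent (v - cos x)` grows only while `v` is close to `cos x`. A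
continuous `v` varies little on short intervals, and then some multiple of `π` is a barrier; the
measurable input `cos (1 / (1 - t))` follows the explosive solution `1 / (1 - t)`. -/

namespace DelaySystem

open Filter

/-! ### Grönwall's inequality -/

section Gronwall

/-- Grönwall's inequality in integral form. -/
theorem le_mul_exp_of_le_add_integral {h : ℝ → ℝ} {a b A K : ℝ} (hK : 0 ≤ K)
    (hc : ContinuousOn h (Icc a b))
    (hle : ∀ t ∈ Icc a b, h t ≤ A + K * ∫ s in a..t, h s) :
    ∀ t ∈ Icc a b, h t ≤ A * Real.exp (K * (t - a)) := by
  intro t ht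
  have hab : a ≤ b := ht.1.trans ht.2
  -- The constant extension beyond `[a, b]` is continuous on the line, so its primitive is
  -- differentiable at the endpoints too.
  set h' : ℝ → ℝ := IccExtend hab ((Icc a b).domRestrict h) with hh'
  have hc' : Continuous h' := (continuousOn_iff_continuous_domRestrict.1 hc).Icc_extend'
  have heq : ∀ s ∈ Icc a b, h' s = h s := fun s hs => by
    rw [hh', IccExtend_of_mem hab _ hs]; rfl
  have hint : ∀ s ∈ Icc a b, ∫ r in a..s, h' r = ∫ r in a..s, h r := fun s hs => by
    refine intervalIntegral.integral_congr fun r hr => ?_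
    rw [uIcc_of_le hs.1] at hr
    exact heq r ⟨hr.1, hr.2.trans hs.2⟩
  have hderiv : ∀ s, HasDerivAt (fun s => A + K * ∫ r in a..s, h' r) (K * h' s) s := fun s =>
    ((intervalIntegral.integral_hasDerivAt_right (hc'.intervalIntegrable _ _)
      (hc'.stronglyMeasurableAtFilter _ _) hc'.continuousAt).const_mul K).const_add A
  have key := le_gronwallBound_of_liminf_deriv_right_le (f := fun s => A + K * ∫ r in a..s, h' r)
    (f' := fun s => K * h' s) (δ := A) (K := K) (ε := 0) (a := a) (b := b)
    (fun s _ => (hderiv s).continuousAt.continuousWithinAt)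
    (fun s _ r hr => (hderiv s).hasDerivWithinAt.liminf_right_slope_le hr)
    (by simp) (fun s hs => by
      have hs' : s ∈ Icc a b := ⟨hs.1, hs.2.le⟩
      rw [heq s hs', add_zero, hint s hs']
      exact mul_le_mul_of_nonneg_left (hle s hs') hK) t ht
  rw [gronwallBound_ε0] at key
  refine (hle t ht).trans ?_
  rw [← hint t ht]
  exact key

end Gronwall

/-! ### Calculus of trajectories in integral form -/

section Trajectories

variable {E W : Type*} [NormedAddCommGroup E] [NormedSpace ℝ E]

/-- `z` is a Carathéodory solution on `[a, b]` of `z' = g (z, w)`, in integral form. -/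
structure IsTraj (g : E × W → E) (w : ℝ → W) (a b : ℝ) (z : ℝ → E) : Prop where
  continuousOn : ContinuousOn z (Icc a b)
  integrableOn : IntegrableOn (fun s => g (z s, w s)) (Icc a b)
  eq_add_integral : ∀ t ∈ Icc a b, z t = z a + ∫ s in a..t, g (z s, w s)

variable {g g' : E × W → E} {w w' : ℝ → W} {a b c d : ℝ} {z z' : ℝ → E}

theorem IsTraj.intervalIntegrable (h : IsTraj g w a b z) (hc : c ∈ Icc a b) (hd : d ∈ Icc a b) :
    IntervalIntegrable (fun s => g (z s, w s)) volume c d :=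
  (h.integrableOn.mono_set ((convex_Icc a b).ordConnected.uIcc_subset hc hd)).intervalIntegrable

theorem IsTraj.mono (h : IsTraj g w a b z) (hac : a ≤ c) (hdb : d ≤ b) : IsTraj g w c d z := by
  have hsub : Icc c d ⊆ Icc a b := Icc_subset_Icc hac hdb
  refine ⟨h.continuousOn.mono hsub, h.integrableOn.mono_set hsub, fun t ht => ?_⟩
  have hc : c ∈ Icc a b := hsub ⟨le_rfl, ht.1.trans ht.2⟩
  have ha : a ∈ Icc a b := ⟨le_rfl, hc.1.trans hc.2⟩
  rw [h.eq_add_integral t (hsub ht), h.eq_add_integral c hc, add_assoc,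
    intervalIntegral.integral_add_adjacent_intervals (h.intervalIntegrable ha hc)
      (h.intervalIntegrable hc (hsub ht))]

/-- Only the values of the field along `z`, up to a null set of times, enter the integral equation.
This serves both to change representatives of inputs and to truncate fields. -/
theorem IsTraj.congr_field (h : IsTraj g w a b z)
    (hg : ∀ᵐ s, s ∈ Icc a b → g (z s, w s) = g' (z s, w' s)) : IsTraj g' w' a b z := by
  refine ⟨h.continuousOn, h.integrableOn.congr ((ae_restrict_iff' measurableSet_Icc).2 hg),
    fun t ht => ?_⟩
  rw [h.eq_add_integral t ht]
  congr 1
  refine intervalIntegral.integral_congr_ae ?_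
  filter_upwards [hg] with s hs hst
  rw [uIoc_of_le ht.1] at hst
  exact hs ⟨hst.1.le, hst.2.trans ht.2⟩

theorem IsTraj.congr (h : IsTraj g w a b z) (hz : EqOn z' z (Icc a b)) : IsTraj g w a b z' := by
  refine ⟨h.continuousOn.congr hz, h.integrableOn.congr_fun (fun s hs => ?_) measurableSet_Icc,
    fun t ht => ?_⟩
  · simp only [hz hs]
  · rw [hz ht, hz ⟨le_rfl, ht.1.trans ht.2⟩, h.eq_add_integral t ht]
    congr 1
    refine intervalIntegral.integral_congr fun s hs => ?_
    rw [uIcc_of_le ht.1] at hs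
    simp only [hz ⟨hs.1, hs.2.trans ht.2⟩]

theorem IsTraj.glue (h₁ : IsTraj g w a b z) (h₂ : IsTraj g w b c z) (hab : a ≤ b) (hbc : b ≤ c) :
    IsTraj g w a c z := by
  have hu : Icc a b ∪ Icc b c = Icc a c := Icc_union_Icc_eq_Icc hab hbc
  refine ⟨?_, ?_, fun t ht => ?_⟩
  · rw [← hu]
    exact h₁.continuousOn.union_of_isClosed h₂.continuousOn isClosed_Icc isClosed_Icc
  · rw [← hu]
    exact h₁.integrableOn.union h₂.integrableOn
  · rcases le_total t b with htb | hbt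
    · exact h₁.eq_add_integral t ⟨ht.1, htb⟩
    · have ht' : t ∈ Icc b c := ⟨hbt, ht.2⟩
      rw [h₂.eq_add_integral t ht', h₁.eq_add_integral b ⟨hab, le_rfl⟩, add_assoc,
        intervalIntegral.integral_add_adjacent_intervals
          (h₁.intervalIntegrable ⟨le_rfl, hab⟩ ⟨hab, le_rfl⟩)
          (h₂.intervalIntegrable ⟨le_rfl, hbc⟩ ht')]

theorem IsTraj.glue_ite (h₁ : IsTraj g w a b z) (h₂ : IsTraj g w b c z') (hab : a ≤ b)
    (hbc : b ≤ c) (hb : z b = z' b) : IsTraj g w a c (fun t => if t ≤ b then z t else z' t) := by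
  refine IsTraj.glue (b := b) (h₁.congr fun t ht => if_pos ht.2) (h₂.congr fun t ht => ?_) hab hbc
  rcases ht.1.eq_or_lt with rfl | hlt
  · simp [hb]
  · exact if_neg hlt.not_ge

theorem IsTraj.shift (h : IsTraj g w (a + c) (b + c) z) :
    IsTraj g (fun s => w (s + c)) a b (fun s => z (s + c)) := by
  have hmaps : MapsTo (fun s => s + c) (Icc a b) (Icc (a + c) (b + c)) := fun s hs =>
    ⟨add_le_add_left hs.1 c, add_le_add_left hs.2 c⟩
  refine ⟨h.continuousOn.comp (by fun_prop) hmaps, ?_, fun t ht => ?_⟩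
  · have := (measurePreserving_add_right volume c).integrableOn_comp_preimage
      (measurableEmbedding_addRight c) (f := fun s => g (z s, w s)) (s := Icc (a + c) (b + c))
    rw [preimage_add_const_Icc, add_sub_cancel_right, add_sub_cancel_right] at this
    exact this.2 h.integrableOn
  · rw [h.eq_add_integral _ (hmaps ht),
      intervalIntegral.integral_comp_add_right (fun s => g (z s, w s))]

/-- Reversing time reduces problems with prescribed final value to initial value problems. -/
theorem IsTraj.reverse (h : IsTraj g w a b z) :
    IsTraj (fun q => -g q) (fun s => w (a + b - s)) a b (fun s => z (a + b - s)) := by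
  have hmaps : MapsTo (fun s => a + b - s) (Icc a b) (Icc a b) := fun s hs =>
    ⟨by linarith [hs.2], by linarith [hs.1]⟩
  refine ⟨h.continuousOn.comp (by fun_prop) hmaps, ?_, fun t ht => ?_⟩
  · have := (Measure.measurePreserving_sub_left volume (a + b)).integrableOn_comp_preimage
      (measurableEmbedding_subLeft (a + b)) (f := fun s => g (z s, w s)) (s := Icc a b)
    rw [preimage_const_sub_Icc, add_sub_cancel_left, add_sub_cancel_right] at this
    exact (this.2 h.integrableOn).neg
  · have hab : a ≤ b := ht.1.trans ht.2
    rw [intervalIntegral.integral_neg,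
      intervalIntegral.integral_comp_sub_left (fun s => g (z s, w s)), add_sub_cancel_left,
      h.eq_add_integral _ (hmaps ht), h.eq_add_integral b ⟨hab, le_rfl⟩,
      ← intervalIntegral.integral_interval_sub_left (a := a) (b := b) (c := a + b - t)
        (h.intervalIntegrable ⟨le_rfl, hab⟩ ⟨hab, le_rfl⟩)
        (h.intervalIntegrable ⟨le_rfl, hab⟩ (hmaps ht))]
    abel

/-- Quantitative continuous dependence of trajectories on initial points and vector fields. -/
theorem IsTraj.norm_sub_le {K : ℝ} {e : ℝ → ℝ} (hK : 0 ≤ K) (h : IsTraj g w a b z)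
    (h' : IsTraj g' w' a b z') (he : IntegrableOn e (Icc a b)) (he0 : ∀ s, 0 ≤ e s)
    (hle : ∀ᵐ s, s ∈ Icc a b → ‖g (z s, w s) - g' (z' s, w' s)‖ ≤ K * ‖z s - z' s‖ + e s) :
    ∀ t ∈ Icc a b,
      ‖z t - z' t‖ ≤ (‖z a - z' a‖ + ∫ s in Icc a b, e s) * Real.exp (K * (t - a)) := by
  have hcont : ContinuousOn (fun s => ‖z s - z' s‖) (Icc a b) :=
    (h.continuousOn.sub h'.continuousOn).norm
  refine le_mul_exp_of_le_add_integral hK hcont fun t ht => ?_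
  have hsub : Icc a t ⊆ Icc a b := Icc_subset_Icc_right ht.2
  have ha : a ∈ Icc a b := ⟨le_rfl, ht.1.trans ht.2⟩
  have hci : IntervalIntegrable (fun s => ‖z s - z' s‖) volume a t :=
    (hcont.mono (by rw [uIcc_of_le ht.1]; exact hsub)).intervalIntegrable
  have hei : IntervalIntegrable e volume a t :=
    (he.mono_set (by rw [uIcc_of_le ht.1]; exact hsub)).intervalIntegrable
  have h1 : z t - z' t = (z a - z' a) + ∫ s in a..t, (g (z s, w s) - g' (z' s, w' s)) := by
    rw [intervalIntegral.integral_sub (h.intervalIntegrable ha ht) (h'.intervalIntegrable ha ht),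
      h.eq_add_integral t ht, h'.eq_add_integral t ht]
    abel
  have h2 : ‖∫ s in a..t, (g (z s, w s) - g' (z' s, w' s))‖
      ≤ ∫ s in a..t, (K * ‖z s - z' s‖ + e s) := by
    refine intervalIntegral.norm_integral_le_of_norm_le ht.1 ?_ ((hci.const_mul K).add hei)
    filter_upwards [hle] with s hs hst
    exact hs ⟨hst.1.le, hst.2.trans ht.2⟩
  have h3 : ∫ s in a..t, e s ≤ ∫ s in Icc a b, e s := by
    rw [intervalIntegral.integral_of_le ht.1]
    exact setIntegral_mono_set he (ae_of_all _ he0)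
      (Ioc_subset_Icc_self.trans hsub : Ioc a t ⊆ Icc a b).eventuallyLE
  rw [intervalIntegral.integral_add (hci.const_mul K) hei,
    intervalIntegral.integral_const_mul] at h2
  rw [h1]
  refine (norm_add_le _ _).trans ?_
  linarith

end Trajectories

/-! ### Truncation, existence and uniqueness -/

section Existence

set_option linter.unusedSectionVars false

variable {E W : Type*} [NormedAddCommGroup E] [NormedSpace ℝ E] [NormedAddCommGroup W]

theorem _root_.MeasureTheory.MemLp.exists_ae_norm_le_on {w : ℝ → W} {S : Set ℝ}
    (hS : MeasurableSet S) (hw : MemLp w ∞ (volume.restrict S)) :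
    ∃ r : ℝ, 0 ≤ r ∧ ∀ᵐ s, s ∈ S → ‖w s‖ ≤ r := by
  refine ⟨(eLpNorm w ∞ (volume.restrict S)).toReal, ENNReal.toReal_nonneg, ?_⟩
  rw [← ae_restrict_iff' hS]
  filter_upwards [ae_le_eLpNormEssSup (f := w) (μ := volume.restrict S)] with s hs
  rw [← toReal_enorm]
  refine ENNReal.toReal_mono hw.2.ne ?_
  rwa [eLpNorm_exponent_top]

theorem memLp_top_of_ae_norm_le {w : ℝ → W} {S : Set ℝ} {r : ℝ} (hS : MeasurableSet S)
    (hw : AEStronglyMeasurable w (volume.restrict S)) (hr : ∀ᵐ s, s ∈ S → ‖w s‖ ≤ r) :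
    MemLp w ∞ (volume.restrict S) :=
  memLp_top_of_bound hw r ((ae_restrict_iff' hS).2 hr)

/-- Radial retraction onto the closed ball of radius `R`. -/
noncomputable def radialRetraction (R : ℝ) (x : E) : E := (R / max R ‖x‖) • x

theorem radialRetraction_of_norm_le {R : ℝ} (hR : 0 < R) {x : E} (hx : ‖x‖ ≤ R) :
    radialRetraction R x = x := by
  rw [radialRetraction, max_eq_left hx, div_self hR.ne', one_smul]

theorem norm_radialRetraction_le {R : ℝ} (hR : 0 < R) (x : E) : ‖radialRetraction R x‖ ≤ R := by
  have h1 : 0 < max R ‖x‖ := hR.trans_le (le_max_left _ _)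
  rw [radialRetraction, norm_smul, Real.norm_of_nonneg (by positivity), div_mul_eq_mul_div,
    div_le_iff₀ h1]
  exact mul_le_mul_of_nonneg_left (le_max_right _ _) hR.le

/-- Moving the point at fixed scaling costs at most `‖x - y‖`, and so does changing the scaling
factor, because `max R ‖·‖` is 1-Lipschitz; hence the constant 2. -/
theorem lipschitzWith_radialRetraction {R : ℝ} (hR : 0 < R) :
    LipschitzWith 2 (radialRetraction R : E → E) := by
  refine LipschitzWith.of_dist_le_mul fun x y => ?_
  rw [dist_eq_norm, dist_eq_norm]
  set a := max R ‖x‖ with ha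
  set b := max R ‖y‖ with hb
  have ha0 : 0 < a := hR.trans_le (le_max_left _ _)
  have hb0 : 0 < b := hR.trans_le (le_max_left _ _)
  have h1 : radialRetraction R x - radialRetraction R y
      = (R / a) • (x - y) + ((R / a) * ((b - a) / b)) • y := by
    rw [radialRetraction, radialRetraction, ← ha, ← hb, smul_sub, sub_add, ← sub_smul]
    congr 2
    field_simp
    ring
  have h2 : |b - a| ≤ ‖x - y‖ := by
    refine (abs_max_sub_max_le_max R ‖y‖ R ‖x‖).trans ?_
    rw [sub_self, abs_zero, max_eq_right (abs_nonneg _), norm_sub_rev]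
    exact abs_norm_sub_norm_le y x
  have h3 : R / a ≤ 1 := (div_le_one ha0).2 (le_max_left _ _)
  have h4 : ‖y‖ / b ≤ 1 := (div_le_one hb0).2 (le_max_right _ _)
  rw [h1]
  refine (norm_add_le _ _).trans ?_
  rw [norm_smul, norm_smul, norm_mul, Real.norm_of_nonneg (by positivity : 0 ≤ R / a), norm_div,
    Real.norm_eq_abs, Real.norm_of_nonneg hb0.le]
  have h5 : R / a * (|b - a| / b) * ‖y‖ = (R / a) * |b - a| * (‖y‖ / b) := by ring
  rw [h5]
  have h6 : R / a * ‖x - y‖ ≤ 1 * ‖x - y‖ := by gcongr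
  have h7 : (R / a) * |b - a| * (‖y‖ / b) ≤ 1 * ‖x - y‖ * 1 := by gcongr
  norm_num
  linarith

/-- `g (x, w)` is Lipschitz in `x` on balls, uniformly with respect to bounded `w`. -/
def LipOnBalls (g : E × W → E) : Prop :=
  ∀ R : ℝ, ∃ L : NNReal, ∀ w : W, ‖w‖ ≤ R →
    LipschitzOnWith L (fun x => g (x, w)) (Metric.closedBall 0 R)

/-- The vector field `g` made constant along rays outside of the ball of radius `R`. -/
noncomputable def cutoff (g : E × W → E) (R : ℝ) (q : E × W) : E := g (radialRetraction R q.1, q.2)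

theorem cutoff_apply {g : E × W → E} {R : ℝ} (hR : 0 < R) {x : E} {w : W} (hx : ‖x‖ ≤ R) :
    cutoff g R (x, w) = g (x, w) := by
  rw [cutoff, radialRetraction_of_norm_le hR hx]

theorem continuous_cutoff {g : E × W → E} {R : ℝ} (hR : 0 < R) (hg : Continuous g) :
    Continuous (cutoff g R) :=
  hg.comp (((lipschitzWith_radialRetraction hR).continuous.comp continuous_fst).prodMk
    continuous_snd)

/-- The retraction maps everything into the ball of radius `R`, where `g` is Lipschitz, so the
truncated field is globally Lipschitz. -/
theorem LipOnBalls.cutoff {g : E × W → E} (hg : LipOnBalls g) {R : ℝ} (hR : 0 < R) (r : ℝ) :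
    ∃ K : NNReal, ∀ w : W, ‖w‖ ≤ r → LipschitzWith K (fun x => cutoff g R (x, w)) := by
  obtain ⟨L, hL⟩ := hg (max R r)
  refine ⟨L * 2, fun w hw => ?_⟩
  rw [← lipschitzOnWith_univ]
  refine (hL w (hw.trans (le_max_right _ _))).comp
    (lipschitzWith_radialRetraction hR).lipschitzOnWith fun x _ => ?_
  rw [mem_closedBall_zero_iff]
  exact (norm_radialRetraction_le hR x).trans (le_max_left _ _)

variable {g : E × W → E} {w : ℝ → W} {a b : ℝ} {z z' : ℝ → E}

theorem IsTraj.cutoff (h : IsTraj g w a b z) {R : ℝ} (hR : 0 < R)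
    (hz : ∀ t ∈ Icc a b, ‖z t‖ ≤ R) : IsTraj (cutoff g R) w a b z :=
  h.congr_field (ae_of_all _ fun s hs => (cutoff_apply hR (hz s hs)).symm)

/-- Existence proofs solve the truncated equation globally and then show by an a priori bound that
the truncation was never active. -/
theorem IsTraj.of_cutoff {R : ℝ} (h : IsTraj (DelaySystem.cutoff g R) w a b z) (hR : 0 < R)
    (hz : ∀ t ∈ Icc a b, ‖z t‖ ≤ R) : IsTraj g w a b z :=
  h.congr_field (ae_of_all _ fun s hs => cutoff_apply hR (hz s hs))

theorem exists_ae_norm_field_le [ProperSpace E] [ProperSpace W] (hg : Continuous g)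
    (hw : MemLp w ∞ (volume.restrict (Icc a b))) (hz : ContinuousOn z (Icc a b)) :
    ∃ M : NNReal, ∀ᵐ s, s ∈ Icc a b → ‖g (z s, w s)‖ ≤ M := by
  obtain ⟨r, -, hr⟩ := hw.exists_ae_norm_le_on measurableSet_Icc
  obtain ⟨R, hR⟩ := isCompact_Icc.exists_bound_of_continuousOn hz
  obtain ⟨M, hM⟩ := ((isCompact_closedBall (0 : E) R).prod
    (isCompact_closedBall (0 : W) r)).exists_bound_of_continuousOn hg.continuousOn
  refine ⟨M.toNNReal, ?_⟩
  filter_upwards [hr] with s hs hsm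
  exact (hM _ ⟨mem_closedBall_zero_iff.2 (hR s hsm),
    mem_closedBall_zero_iff.2 (hs hsm)⟩).trans (Real.le_coe_toNNReal M)

theorem integrableOn_field [ProperSpace E] [ProperSpace W] (hg : Continuous g)
    (hw : MemLp w ∞ (volume.restrict (Icc a b))) (hz : ContinuousOn z (Icc a b)) :
    IntegrableOn (fun s => g (z s, w s)) (Icc a b) := by
  obtain ⟨M, hM⟩ := exists_ae_norm_field_le hg hw hz
  have : IsFiniteMeasure (volume.restrict (Icc a b)) := ⟨by simp⟩
  exact Integrable.of_bound (hg.comp_aestronglyMeasurable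
    ((hz.aestronglyMeasurable measurableSet_Icc).prodMk hw.1)) M
    ((ae_restrict_iff' measurableSet_Icc).2 hM)

/-- A trajectory extends step by step if the steps have a uniform length. -/
theorem exists_isTraj_of_step {δ T : ℝ} (hδ : 0 < δ)
    (hstep : ∀ t₀ ∈ Icc a T, ∀ x : E, ∃ z : ℝ → E, z t₀ = x ∧ IsTraj g w t₀ (t₀ + δ) z) (x : E) :
    ∃ z : ℝ → E, z a = x ∧ IsTraj g w a T z := by
  -- Only the start of the last step has to lie before `T`; the trajectory may overshoot `T` and is
  -- restricted at the end.
  have key : ∀ N : ℕ, a + N * δ ≤ T → ∃ z : ℝ → E, z a = x ∧ IsTraj g w a (a + (N + 1) * δ) z := by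
    intro N
    induction N with
    | zero =>
      intro h
      simpa using hstep a ⟨le_rfl, by simpa using h⟩ x
    | succ N ih =>
      intro h
      push_cast at h
      obtain ⟨z, hz, hzt⟩ := ih (by nlinarith)
      have hN : (0 : ℝ) ≤ N * δ := by positivity
      obtain ⟨z', hz', hzt'⟩ := hstep (a + (N + 1) * δ) ⟨by nlinarith, h⟩ (z (a + (N + 1) * δ))
      have h1 : a ≤ a + (N + 1) * δ := by nlinarith
      refine ⟨fun t => if t ≤ a + (N + 1) * δ then z t else z' t, by simp [h1, hz], ?_⟩
      convert! hzt.glue_ite hzt' h1 (by linarith) hz'.symm using 1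
      push_cast
      ring
  rcases lt_or_ge T a with hTa | hTa
  · exact ⟨fun _ => x, rfl, by simp [Icc_eq_empty hTa.not_ge],
      by simp [Icc_eq_empty hTa.not_ge], by simp [Icc_eq_empty hTa.not_ge]⟩
  · obtain ⟨z, hz, hzt⟩ := key ⌊(T - a) / δ⌋₊ (by
      have := (le_div_iff₀ hδ).1 (Nat.floor_le (div_nonneg (sub_nonneg.2 hTa) hδ.le))
      linarith)
    refine ⟨z, hz, hzt.mono le_rfl ?_⟩
    have := (div_lt_iff₀ hδ).1 (Nat.lt_floor_add_one ((T - a) / δ))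
    linarith

/-- Global existence for globally Lipschitz vector fields on a short time interval. -/
theorem exists_isTraj_of_lipschitz_of_short [ProperSpace E] [ProperSpace W] {K : NNReal} {r : ℝ}
    (hg : Continuous g) (hlip : ∀ w : W, ‖w‖ ≤ r → LipschitzWith K (fun x => g (x, w)))
    (hab : a ≤ b) (hK : K * (b - a) < 1) (hw : MemLp w ∞ (volume.restrict (Icc a b)))
    (hr : ∀ᵐ s, s ∈ Icc a b → ‖w s‖ ≤ r) (x : E) :
    ∃ z : ℝ → E, z a = x ∧ IsTraj g w a b z := by
  have hint : ∀ y : C(Icc a b, E),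
      IntegrableOn (fun s => g (IccExtend hab y s, w s)) (Icc a b) := fun y =>
    integrableOn_field hg hw y.continuous.Icc_extend'.continuousOn
  have ha : a ∈ Icc a b := ⟨le_rfl, hab⟩
  have hii : ∀ (y : C(Icc a b, E)) (t : Icc a b),
      IntervalIntegrable (fun s => g (IccExtend hab y s, w s)) volume a t := fun y t =>
    ((hint y).mono_set ((convex_Icc a b).ordConnected.uIcc_subset ha t.2)).intervalIntegrable
  have hcont : ∀ y : C(Icc a b, E), Continuous
      (fun t : Icc a b => x + ∫ s in a..t, g (IccExtend hab y s, w s)) := fun y => by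
    refine continuous_const.add (ContinuousOn.comp_continuous (s := Icc a b) (f := Subtype.val)
      (g := fun t => ∫ s in a..t, g (IccExtend hab y s, w s)) ?_ continuous_subtype_val
      fun t => t.2)
    have := intervalIntegral.continuousOn_primitive_interval (a := a) (b := b)
      (f := fun s => g (IccExtend hab y s, w s)) (μ := volume)
      (by rw [uIcc_of_le hab]; exact hint y)
    rwa [uIcc_of_le hab] at this
  -- The Picard operator, a contraction of ratio `K * (b - a)` for the supremum distance.
  let P : C(Icc a b, E) → C(Icc a b, E) := fun y => ⟨_, hcont y⟩
  have hba : 0 ≤ b - a := sub_nonneg.2 hab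
  have hP : ContractingWith (K * (b - a).toNNReal) P := by
    refine ⟨?_, LipschitzWith.of_dist_le_mul fun y y' => ?_⟩
    · rw [← NNReal.coe_lt_coe]
      push_cast
      rwa [Real.coe_toNNReal _ hba]
    · rw [ContinuousMap.dist_le (by positivity)]
      intro t
      have h1 : P y t - P y' t
          = ∫ s in a..t, (g (IccExtend hab y s, w s) - g (IccExtend hab y' s, w s)) := by
        rw [intervalIntegral.integral_sub (hii y t) (hii y' t)]
        exact add_sub_add_left_eq_sub _ _ _
      rw [dist_eq_norm, h1]
      have h2 : ‖∫ s in a..t, (g (IccExtend hab y s, w s) - g (IccExtend hab y' s, w s))‖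
          ≤ (K * dist y y') * |t - a| := by
        refine intervalIntegral.norm_integral_le_of_norm_le_const_ae ?_
        filter_upwards [hr] with s hs hst
        rw [uIoc_of_le t.2.1] at hst
        have hs' : s ∈ Icc a b := ⟨hst.1.le, hst.2.trans t.2.2⟩
        rw [← dist_eq_norm, IccExtend_of_mem hab _ hs', IccExtend_of_mem hab _ hs']
        exact ((hlip (w s) (hs hs')).dist_le_mul _ _).trans
          (mul_le_mul_of_nonneg_left (ContinuousMap.dist_apply_le_dist _) K.2)
      refine h2.trans ?_
      rw [abs_of_nonneg (sub_nonneg.2 t.2.1)]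
      push_cast
      rw [Real.coe_toNNReal _ hba, mul_right_comm]
      have h3 : (t : ℝ) - a ≤ b - a := sub_le_sub_right t.2.2 a
      gcongr
  have : Nonempty C(Icc a b, E) := ⟨ContinuousMap.const _ 0⟩
  obtain ⟨y, hy⟩ : ∃ y, P y = y := ⟨ContractingWith.fixedPoint P hP, hP.fixedPoint_isFixedPt⟩
  have hy' : ∀ t : Icc a b, y t = x + ∫ s in a..t, g (IccExtend hab y s, w s) := fun t =>
    (DFunLike.congr_fun hy t).symm
  have hya : IccExtend hab y a = x := by
    rw [IccExtend_of_mem hab _ ha, hy']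
    simp
  refine ⟨IccExtend hab y, hya, y.continuous.Icc_extend'.continuousOn, hint y, fun t ht => ?_⟩
  rw [hya, IccExtend_of_mem hab _ ht, hy']

/-- Global existence for globally Lipschitz vector fields. -/
theorem exists_isTraj_of_lipschitz [ProperSpace E] [ProperSpace W] {K : NNReal} {r : ℝ}
    (hg : Continuous g) (hlip : ∀ w : W, ‖w‖ ≤ r → LipschitzWith K (fun x => g (x, w)))
    (hw : MemLp w ∞ (volume.restrict (Icc a b))) (hr : ∀ᵐ s, s ∈ Icc a b → ‖w s‖ ≤ r) (x : E) :
    ∃ z : ℝ → E, z a = x ∧ IsTraj g w a b z := by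
  classical
  -- The last step may leave `[a, b]`, so the input is extended by zero. The step length `1 / (K +
  -- 1)` makes the Picard operator a contraction.
  set w' : ℝ → W := (Icc a b).indicator w with hw'
  have hδ : (0 : ℝ) < 1 / (K + 1) := by positivity
  have heq : ∀ s ∈ Icc a b, w' s = w s := fun s hs => indicator_of_mem hs w
  have hmem : MemLp w' ∞ volume := (memLp_indicator_iff_restrict measurableSet_Icc).2 hw
  -- A negative bound forces `[a, b]` to be a null set, where constants are trajectories; otherwise
  -- the zero extension satisfies the bound.
  rcases lt_or_ge r 0 with hr0 | hr0
  · have hnull : ∀ᵐ s, s ∉ Icc a b := by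
      filter_upwards [hr] with s hs hsm
      exact absurd (hs hsm) (not_le.2 (hr0.trans_le (norm_nonneg _)))
    have h0 : volume.restrict (Icc a b) = 0 := by
      rw [Measure.restrict_eq_zero]
      exact measure_eq_zero_iff_ae_notMem.2 hnull
    refine ⟨fun _ => x, rfl, continuousOn_const, ?_, fun t ht => ?_⟩
    · rw [IntegrableOn, h0]; exact integrable_zero_measure
    · have h1 : volume.restrict (Ioc a t) = 0 :=
        Measure.restrict_eq_zero.2 (measure_mono_null
          (Ioc_subset_Icc_self.trans (Icc_subset_Icc_right ht.2)) (Measure.restrict_eq_zero.1 h0))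
      rw [intervalIntegral.integral_of_le ht.1, h1, integral_zero_measure, add_zero]
  have hr' : ∀ᵐ s, ‖w' s‖ ≤ r := by
    filter_upwards [hr] with s hs
    by_cases hsm : s ∈ Icc a b
    · rw [heq s hsm]; exact hs hsm
    · rw [hw', indicator_of_notMem hsm, norm_zero]; exact hr0
  obtain ⟨z, hz, hzt⟩ := exists_isTraj_of_step (g := g) (w := w') (a := a) (T := b) hδ
    (fun t₀ _ x => exists_isTraj_of_lipschitz_of_short hg hlip (by linarith) (by
      rw [add_sub_cancel_left, mul_one_div, div_lt_one (by positivity)]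
      linarith) (hmem.restrict _) (hr'.mono fun s hs _ => hs) x) x
  exact ⟨z, hz, hzt.congr_field (ae_of_all _ fun s hs => by rw [heq s hs])⟩

/-- Existence for globally Lipschitz vector fields with prescribed final value. -/
theorem exists_isTraj_of_lipschitz_final [ProperSpace E] [ProperSpace W] {K : NNReal} {r : ℝ}
    (hg : Continuous g) (hlip : ∀ w : W, ‖w‖ ≤ r → LipschitzWith K (fun x => g (x, w)))
    (hw : MemLp w ∞ (volume.restrict (Icc a b))) (hr : ∀ᵐ s, s ∈ Icc a b → ‖w s‖ ≤ r) (x : E) :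
    ∃ z : ℝ → E, z b = x ∧ IsTraj g w a b z := by
  have hmp := Measure.measurePreserving_sub_left (volume : Measure ℝ) (a + b)
  have hmp' : MeasurePreserving (fun s => a + b - s) (volume.restrict (Icc a b))
      (volume.restrict (Icc a b)) := by
    have := hmp.restrict_preimage (s := Icc a b) measurableSet_Icc
    rwa [preimage_const_sub_Icc, add_sub_cancel_left, add_sub_cancel_right] at this
  obtain ⟨z, hz, hzt⟩ := exists_isTraj_of_lipschitz (g := fun q => -g q)
    (w := fun s => w (a + b - s)) (a := a) (b := b) hg.neg
    (fun w hw => (hlip w hw).neg) (hw.comp_measurePreserving hmp') (by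
      filter_upwards [hmp.quasiMeasurePreserving.ae hr] with s hs hsm
      exact hs ⟨by linarith [hsm.2], by linarith [hsm.1]⟩) x
  refine ⟨fun s => z (a + b - s), by simpa using hz, ?_⟩
  simpa using hzt.reverse

theorem IsTraj.norm_sub_le_of_lipschitz {K : NNReal} {r : ℝ}
    (hlip : ∀ w : W, ‖w‖ ≤ r → LipschitzWith K (fun x => g (x, w)))
    (hr : ∀ᵐ s, s ∈ Icc a b → ‖w s‖ ≤ r) (h : IsTraj g w a b z) (h' : IsTraj g w a b z') :
    ∀ t ∈ Icc a b, ‖z t - z' t‖ ≤ ‖z a - z' a‖ * Real.exp (K * (t - a)) := by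
  have := IsTraj.norm_sub_le (e := fun _ => 0) K.2 h h' integrableOn_zero (fun _ => le_rfl) (by
    filter_upwards [hr] with s hs hsm
    rw [add_zero, ← dist_eq_norm, ← dist_eq_norm]
    exact (hlip _ (hs hsm)).dist_le_mul _ _)
  simpa using this

theorem IsTraj.norm_sub_le_final_of_lipschitz {K : NNReal} {r : ℝ}
    (hlip : ∀ w : W, ‖w‖ ≤ r → LipschitzWith K (fun x => g (x, w)))
    (hr : ∀ᵐ s, s ∈ Icc a b → ‖w s‖ ≤ r) (h : IsTraj g w a b z) (h' : IsTraj g w a b z') :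
    ∀ t ∈ Icc a b, ‖z t - z' t‖ ≤ ‖z b - z' b‖ * Real.exp (K * (b - t)) := by
  intro t ht
  have hmp := Measure.measurePreserving_sub_left (volume : Measure ℝ) (a + b)
  have := IsTraj.norm_sub_le_of_lipschitz (g := fun q => -g q) (fun w hw => (hlip w hw).neg)
    (by
      filter_upwards [hmp.quasiMeasurePreserving.ae hr] with s hs hsm
      exact hs ⟨by linarith [hsm.2], by linarith [hsm.1]⟩) h.reverse h'.reverse (a + b - t)
    ⟨by linarith [ht.2], by linarith [ht.1]⟩
  simp only [sub_sub_cancel, add_sub_cancel_left] at this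
  convert this using 4
  ring

/-- Uniqueness of trajectories. -/
theorem IsTraj.eqOn (hL : LipOnBalls g) (hw : MemLp w ∞ (volume.restrict (Icc a b)))
    (h : IsTraj g w a b z) (h' : IsTraj g w a b z') (ha : z a = z' a) : EqOn z z' (Icc a b) := by
  obtain ⟨r, -, hr⟩ := hw.exists_ae_norm_le_on measurableSet_Icc
  obtain ⟨R, hR⟩ := isCompact_Icc.exists_bound_of_continuousOn h.continuousOn
  obtain ⟨R', hR'⟩ := isCompact_Icc.exists_bound_of_continuousOn h'.continuousOn
  -- Both trajectories stay in the ball of this radius, so both solve the same globally Lipschitz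
  -- truncated equation.
  have h0 : 0 < max (max R R') 1 := lt_max_of_lt_right one_pos
  obtain ⟨K, hK⟩ := hL.cutoff h0 r
  intro t ht
  have := IsTraj.norm_sub_le_of_lipschitz hK hr
    (h.cutoff h0 fun t ht => (hR t ht).trans (le_max_of_le_left (le_max_left _ _)))
    (h'.cutoff h0 fun t ht => (hR' t ht).trans (le_max_of_le_left (le_max_right _ _))) t ht
  rw [ha, sub_self, norm_zero, zero_mul] at this
  exact sub_eq_zero.1 (norm_le_zero_iff.1 this)

/-- Trajectories on all compact intervals give a global trajectory. -/
theorem exists_global_isTraj (hL : LipOnBalls g)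
    (hw : ∀ T, MemLp w ∞ (volume.restrict (Icc 0 T))) {x : E}
    (h : ∀ T : ℝ, ∃ z : ℝ → E, z 0 = x ∧ IsTraj g w 0 T z) :
    ∃ z : ℝ → E, z 0 = x ∧ ∀ T, IsTraj g w 0 T z := by
  choose Z hZ0 hZ using h
  -- The value at `t` is read off the trajectory on `[0, t]`; by uniqueness all longer ones give the
  -- same value.
  refine ⟨fun t => Z t t, hZ0 0, fun T => (hZ T).congr fun t ht => ?_⟩
  exact IsTraj.eqOn hL (hw t) (hZ t) ((hZ T).mono le_rfl ht.2) ((hZ0 t).trans (hZ0 T).symm)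
    ⟨ht.1, le_rfl⟩

end Existence

/-! ### From forward completeness to bounded reachability -/

section BoundedReachability

variable {E W : Type*} [NormedAddCommGroup E] [NormedSpace ℝ E] [NormedAddCommGroup W]
  {g : E × W → E} {w : ℝ → W} {a b r R T : ℝ} {z z' : ℝ → E}

/-- `w` is strongly measurable with values in the closed ball of radius `r`. -/
def IsBoundedInput (r : ℝ) (w : ℝ → W) : Prop := StronglyMeasurable w ∧ ∀ t, ‖w t‖ ≤ r

theorem IsBoundedInput.memLp (hw : IsBoundedInput r w) (a b : ℝ) :
    MemLp w ∞ (volume.restrict (Icc a b)) :=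
  memLp_top_of_bound hw.1.aestronglyMeasurable r (ae_of_all _ hw.2)

theorem IsBoundedInput.shift (hw : IsBoundedInput r w) (c : ℝ) :
    IsBoundedInput r (fun t => w (t + c)) :=
  ⟨hw.1.comp_measurable (measurable_id.add_const c), fun t => hw.2 (t + c)⟩

/-- Trajectories ending near a bounded trajectory start near it. -/
theorem exists_isTraj_final_near [ProperSpace E] [ProperSpace W] (hg : Continuous g)
    (hL : LipOnBalls g) (r T : ℝ) (hR : 0 ≤ R) :
    ∃ C : ℝ, 0 < C ∧ ∀ w : ℝ → W, IsBoundedInput r w → ∀ s ∈ Icc 0 T, ∀ z : ℝ → E,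
      IsTraj g w 0 s z → (∀ t ∈ Icc 0 s, ‖z t‖ ≤ R) → ∀ y : E, C * ‖y - z s‖ ≤ 1 →
      ∃ z' : ℝ → E, z' s = y ∧ IsTraj g w 0 s z' ∧ ‖z' 0 - z 0‖ ≤ C * ‖y - z s‖ := by
  have hR1 : 0 < R + 1 := by linarith
  -- The radius `R + 1` leaves room for a deviation of size at most 1, so the truncation stays
  -- inactive. The constant `exp (K * T)` does not depend on the input or the trajectory.
  obtain ⟨K, hK⟩ := hL.cutoff hR1 r
  refine ⟨Real.exp (K * T), Real.exp_pos _, fun w hw s hs z hz hzR y hy => ?_⟩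
  obtain ⟨z', hz's, hz'⟩ := exists_isTraj_of_lipschitz_final (continuous_cutoff hR1 hg) hK
    (hw.memLp 0 s) (ae_of_all _ fun t _ => hw.2 t) y
  have hle : ∀ t ∈ Icc 0 s, ‖z' t - z t‖ ≤ Real.exp (K * T) * ‖y - z s‖ := by
    intro t ht
    have := hz'.norm_sub_le_final_of_lipschitz hK (ae_of_all _ fun t _ => hw.2 t)
      (hz.cutoff hR1 fun t ht => (hzR t ht).trans (by linarith)) t ht
    rw [hz's, mul_comm] at this
    refine this.trans ?_
    gcongr
    linarith [ht.1, hs.2]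
  refine ⟨z', hz's, hz'.of_cutoff hR1 fun t ht => ?_, hle 0 ⟨le_rfl, hs.1⟩⟩
  have h1 := norm_le_norm_add_norm_sub' (z' t) (z t)
  linarith [hle t ht, hzR t ht]

/-- Trajectories starting near a bounded trajectory exist as long as it does. -/
theorem exists_isTraj_initial_near [ProperSpace E] [ProperSpace W] (hg : Continuous g)
    (hL : LipOnBalls g) (r T : ℝ) (hR : 0 ≤ R) :
    ∃ C : ℝ, 0 < C ∧ ∀ w : ℝ → W, IsBoundedInput r w → ∀ s ∈ Icc 0 T, ∀ z : ℝ → E,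
      IsTraj g w 0 s z → (∀ t ∈ Icc 0 s, ‖z t‖ ≤ R) → ∀ y : E, C * ‖y - z 0‖ ≤ 1 →
      ∃ z' : ℝ → E, z' 0 = y ∧ IsTraj g w 0 s z' ∧ ∀ t ∈ Icc 0 s, ‖z' t‖ ≤ R + 1 := by
  have hR1 : 0 < R + 1 := by linarith
  obtain ⟨K, hK⟩ := hL.cutoff hR1 r
  refine ⟨Real.exp (K * T), Real.exp_pos _, fun w hw s hs z hz hzR y hy => ?_⟩
  obtain ⟨z', hz's, hz'⟩ := exists_isTraj_of_lipschitz (continuous_cutoff hR1 hg) hK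
    (hw.memLp 0 s) (ae_of_all _ fun t _ => hw.2 t) y
  have hle : ∀ t ∈ Icc 0 s, ‖z' t‖ ≤ R + 1 := by
    intro t ht
    have := hz'.norm_sub_le_of_lipschitz hK (ae_of_all _ fun t _ => hw.2 t)
      (hz.cutoff hR1 fun t ht => (hzR t ht).trans (by linarith)) t ht
    rw [hz's, mul_comm] at this
    have h2 : Real.exp (K * (t - 0)) * ‖y - z 0‖ ≤ Real.exp (K * T) * ‖y - z 0‖ := by
      gcongr
      linarith [ht.2, hs.2]
    have h1 := norm_le_norm_add_norm_sub' (z' t) (z t)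
    linarith [hzR t ht]
  exact ⟨z', hz's, hz'.of_cutoff hR1 hle, hle⟩

/-- The trajectories starting near `x` are unbounded within times slightly larger than `T`. -/
def UnboundedNear (g : E × W → E) (r T : ℝ) (x : E) : Prop :=
  ∀ ε > 0, ∀ N : ℝ, ∃ w : ℝ → W, IsBoundedInput r w ∧ ∃ (z : ℝ → E) (t : ℝ), ‖z 0 - x‖ < ε ∧
    0 ≤ t ∧ t < T + ε ∧ IsTraj g w 0 t z ∧ N ≤ ‖z t‖

theorem UnboundedNear.nonneg {x : E} (h : UnboundedNear g r T x) : 0 ≤ T := by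
  by_contra! hT
  obtain ⟨w, -, z, t, -, h0, ht, -⟩ := h (-T) (by linarith) 0
  linarith

/-- A continuous function has a first time at which it reaches a value from below. -/
theorem exists_first_hitting {h : ℝ → ℝ} {T R : ℝ} (hT : 0 ≤ T) (hc : ContinuousOn h (Icc 0 T))
    (h0 : h 0 ≤ R) (hR : R ≤ h T) :
    ∃ s ∈ Icc 0 T, h s = R ∧ ∀ t ∈ Icc 0 s, h t ≤ R := by
  have hcl : IsCompact (Icc 0 T ∩ h ⁻¹' Ici R) :=
    isCompact_Icc.of_isClosed_subset (hc.preimage_isClosed_of_isClosed isClosed_Icc isClosed_Ici)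
      inter_subset_left
  obtain ⟨s, ⟨hs, hsR⟩, hleast⟩ := hcl.exists_isLeast ⟨T, ⟨hT, le_rfl⟩, hR⟩
  have hsR' : h s = R := by
    obtain ⟨s', hs', hs'R⟩ := intermediate_value_Icc hs.1
      (hc.mono (Icc_subset_Icc_right hs.2)) ⟨h0, hsR⟩
    have : s = s' := le_antisymm
      (hleast ⟨⟨hs'.1, hs'.2.trans hs.2⟩, hs'R.ge⟩) hs'.2
    rw [this, hs'R]
  refine ⟨s, hs, hsR', fun t ht => ?_⟩
  by_contra! hlt
  have : s = t := le_antisymm (hleast ⟨⟨ht.1, ht.2.trans hs.2⟩, hlt.le⟩) ht.2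
  exact absurd hlt (by rw [← this, hsR']; exact lt_irrefl _)

/-- Unboundedness propagates along trajectories through every larger sphere. -/
theorem UnboundedNear.exists_next [ProperSpace E] [ProperSpace W] (hg : Continuous g)
    (hL : LipOnBalls g) {x : E} (h : UnboundedNear g r T x) (hx : ‖x‖ < R) :
    ∃ (τ : ℝ) (x' : E), ‖x'‖ = R ∧ UnboundedNear g r (T - τ) x' ∧
      ∀ ε > 0, ∃ w : ℝ → W, IsBoundedInput r w ∧ ∃ (z : ℝ → E) (s : ℝ), 0 ≤ s ∧ |s - τ| < ε ∧
        ‖z 0 - x‖ < ε ∧ IsTraj g w 0 s z ∧ z s = x' := by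
  have hR0 : 0 ≤ R := (norm_nonneg x).trans hx.le
  have hT := h.nonneg
  -- The second entry keeps the initial points inside the ball of radius `R`; together with the
  -- level `max j R` it forces a crossing of the sphere.
  have hε : ∀ j : ℕ, 0 < min (1 / ((j : ℝ) + 1)) (R - ‖x‖) := fun j =>
    lt_min (by positivity) (sub_pos.2 hx)
  choose w hw z t hz0 ht0 htT hz hzt using fun j : ℕ => h _ (hε j) (max j R)
  have hz0R : ∀ j, ‖z j 0‖ ≤ R := fun j => by
    have h1 := norm_le_norm_add_norm_sub' (z j 0) x
    linarith [hz0 j, min_le_right (1 / ((j : ℝ) + 1)) (R - ‖x‖)]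
  choose s hs hsR hsle using fun j => exists_first_hitting (ht0 j) (hz j).continuousOn.norm
    (hz0R j) ((le_max_right _ _).trans (hzt j))
  have hj1 : ∀ j : ℕ, 1 / ((j : ℝ) + 1) ≤ 1 := fun j => by
    rw [div_le_one (by positivity)]; linarith [(Nat.cast_nonneg j : (0 : ℝ) ≤ j)]
  have hsT : ∀ j, s j ∈ Icc 0 (T + 1) := fun j => ⟨(hs j).1, by
    linarith [(hs j).2, htT j, min_le_left (1 / ((j : ℝ) + 1)) (R - ‖x‖), hj1 j]⟩
  -- First hitting times and hitting points lie in a compact set; `(τ, x')` is a cluster point.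
  obtain ⟨⟨τ, x'⟩, ⟨-, hx'⟩, φ, hφ, hlim⟩ :=
    (isCompact_Icc.prod (isCompact_sphere (0 : E) R)).tendsto_subseq
      (x := fun j => (s j, z j (s j))) fun j => ⟨hsT j, mem_sphere_zero_iff_norm.2 (hsR j)⟩
  have hlims : Tendsto (fun j => s (φ j)) atTop (𝓝 τ) := (continuous_fst.tendsto _).comp hlim
  have hlimz : Tendsto (fun j => z (φ j) (s (φ j))) atTop (𝓝 x') :=
    (continuous_snd.tendsto _).comp hlim
  have hinv : Tendsto (fun j => 1 / ((φ j : ℝ) + 1)) atTop (𝓝 0) :=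
    tendsto_one_div_add_atTop_nhds_zero_nat.comp hφ.tendsto_atTop
  refine ⟨τ, x', mem_sphere_zero_iff_norm.1 hx', fun ε hε N => ?_, fun ε hε => ?_⟩
  -- After the hitting time, the remaining piece of a trajectory of large index starts near `x'` and
  -- still becomes large within the remaining time.
  · have e1 := Metric.tendsto_nhds.1 hlims (ε / 2) (by positivity)
    have e2 := Metric.tendsto_nhds.1 hlimz ε hε
    have e3 := hinv.eventually_lt_const (half_pos hε)
    have e4 := (tendsto_natCast_atTop_atTop.comp hφ.tendsto_atTop).eventually_ge_atTop N
    obtain ⟨j, h1, h2, h3, h4⟩ := (e1.and (e2.and (e3.and e4))).exists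
    refine ⟨_, (hw (φ j)).shift (s (φ j)), fun q => z (φ j) (q + s (φ j)),
      t (φ j) - s (φ j), ?_, by linarith [(hs (φ j)).2], ?_, ?_, ?_⟩
    · simpa [dist_eq_norm] using h2
    · rw [Real.dist_eq] at h1
      linarith [htT (φ j), min_le_left (1 / ((φ j : ℝ) + 1)) (R - ‖x‖), (abs_lt.1 h1).1]
    · refine IsTraj.shift ?_
      rw [zero_add, sub_add_cancel]
      exact (hz (φ j)).mono (hs (φ j)).1 le_rfl
    · dsimp only
      rw [sub_add_cancel]
      exact le_trans (le_trans h4 (le_max_left _ _)) (hzt (φ j))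
  -- Before the hitting time, the trajectory is re-solved backwards with the same input so as to end
  -- exactly at `x'`; its initial point moves by at most `ε / 2`.
  · obtain ⟨C, hC, hshadow⟩ := exists_isTraj_final_near hg hL r (T + 1) hR0
    have e1 := Metric.tendsto_nhds.1 hlims ε hε
    have e2 := Metric.tendsto_nhds.1 hlimz (min 1 (ε / 2) / C) (by positivity)
    have e3 := hinv.eventually_lt_const (half_pos hε)
    obtain ⟨j, h1, h2, h3⟩ := (e1.and (e2.and e3)).exists
    have h2' : C * ‖x' - z (φ j) (s (φ j))‖ < min 1 (ε / 2) := by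
      rw [dist_eq_norm, norm_sub_rev, lt_div_iff₀ hC] at h2
      linarith
    obtain ⟨z', hz's, hz', hz'0⟩ := hshadow (w (φ j)) (hw _) (s (φ j)) (hsT _) (z (φ j))
      ((hz _).mono le_rfl (hs _).2) (hsle _) x' (h2'.le.trans (min_le_left _ _))
    refine ⟨w (φ j), hw _, z', s (φ j), (hs _).1, by rwa [Real.dist_eq] at h1, ?_, hz', hz's⟩
    have h5 := norm_sub_le_norm_sub_add_norm_sub (z' 0) (z (φ j) 0) x
    linarith [hz0 (φ j), min_le_left (1 / ((φ j : ℝ) + 1)) (R - ‖x‖), min_le_right (1 : ℝ) (ε / 2)]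

/-- A point reached from the unit ball around `c` at time `S` by means of the input `w`, near
which trajectories are unbounded within the remaining time `T`, where `S + T < B`. -/
structure ReachesUnbounded (g : E × W → E) (r B : ℝ) (c : E) (p : (ℝ → W) × ℝ × E × ℝ) :
    Prop where
  input : IsBoundedInput r p.1
  nonneg : 0 ≤ p.2.1
  lt : p.2.1 + p.2.2.2 < B
  unbounded : UnboundedNear g r p.2.2.2 p.2.2.1
  traj : ∃ z : ℝ → E, ‖z 0 - c‖ < 1 ∧ IsTraj g p.1 0 p.2.1 z ∧ z p.2.1 = p.2.2.1

/-- The next piece starts near `x`, not at `x`. The old trajectory is therefore re-solved backwards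
from the start of the new piece under the unchanged old input, so that only its initial point moves.
The strict inequalities in `ReachesUnbounded` absorb the errors in position and time. -/
theorem ReachesUnbounded.exists_next [ProperSpace E] [ProperSpace W] (hg : Continuous g)
    (hL : LipOnBalls g) {B : ℝ} {c : E} {p : (ℝ → W) × ℝ × E × ℝ}
    (hp : ReachesUnbounded g r B c p) :
    ∃ p' : (ℝ → W) × ℝ × E × ℝ, ReachesUnbounded g r B c p' ∧ p.2.1 ≤ p'.2.1 ∧
      (∀ t < p.2.1, p'.1 t = p.1 t) ∧ ‖p'.2.2.1‖ = ‖p.2.2.1‖ + 1 := by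
  obtain ⟨w, S, x, T⟩ := p
  obtain ⟨hw, hS, hB, hunb, z, hz0, hz, hzS⟩ := hp
  dsimp only at hw hS hB hunb hz hzS ⊢
  obtain ⟨τ, x', hx', hunb', hreach⟩ := hunb.exists_next hg hL (lt_add_one ‖x‖)
  obtain ⟨R, hR⟩ := isCompact_Icc.exists_bound_of_continuousOn hz.continuousOn
  have hR0 : 0 ≤ R := (norm_nonneg _).trans (hR 0 ⟨le_rfl, hS⟩)
  obtain ⟨C, hC, hshadow⟩ := exists_isTraj_final_near hg hL r S hR0
  -- `ε` is small against the distance left to the unit sphere around `c`, after amplification by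
  -- `C`, and against the spare time.
  obtain ⟨ε, hε, hε1⟩ : ∃ ε > 0, C * ε < min 1 (1 - ‖z 0 - c‖) ∧ ε < B - (S + T) := by
    have h1 : 0 < min 1 (1 - ‖z 0 - c‖) := lt_min one_pos (by linarith)
    have h2 : 0 < min (min 1 (1 - ‖z 0 - c‖) / C) (B - (S + T)) :=
      lt_min (by positivity) (by linarith)
    obtain ⟨ε, hε, hε'⟩ := exists_between h2
    refine ⟨ε, hε, ?_, hε'.trans_le (min_le_right _ _)⟩
    have := hε'.trans_le (min_le_left _ _)
    rw [lt_div_iff₀ hC] at this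
    linarith
  obtain ⟨w', hw', z', s, hs, hsτ, hz'0, hz', hz's⟩ := hreach ε hε
  have hCε : C * ‖z' 0 - z S‖ < min 1 (1 - ‖z 0 - c‖) := by
    rw [hzS]
    exact (mul_lt_mul_of_pos_left hz'0 hC).trans hε1.1
  obtain ⟨z'', hz''S, hz'', hz''0⟩ := hshadow w hw S ⟨hS, le_rfl⟩ z hz hR (z' 0)
    (hCε.le.trans (min_le_left _ _))
  refine ⟨(fun t => if t < S then w t else w' (t - S), S + s, x', T - τ),
    ⟨⟨?_, fun t => ?_⟩, by positivity, ?_, hunb',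
      fun t => if t ≤ S then z'' t else z' (t - S), ?_, ?_, ?_⟩, ?_, fun t ht => if_pos ht, hx'⟩
  · exact StronglyMeasurable.ite measurableSet_Iio hw.1
      (hw'.1.comp_measurable (measurable_id.sub_const S))
  · dsimp only
    split_ifs
    exacts [hw.2 _, hw'.2 _]
  · dsimp only
    linarith [(abs_lt.1 hsτ).2, hε1.2]
  · dsimp only
    rw [if_pos hS]
    have h5 := norm_sub_le_norm_sub_add_norm_sub (z'' 0) (z 0) c
    linarith [min_le_right 1 (1 - ‖z 0 - c‖)]
  · refine IsTraj.glue_ite (b := S) ?_ ?_ hS (by simpa using hs) ?_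
    · refine hz''.congr_field ?_
      filter_upwards [Measure.ae_ne volume S] with t ht htS
      rw [if_pos (lt_of_le_of_ne htS.2 ht)]
    · have h6 : IsTraj g w' (S + -S) (S + s + -S) z' := by
        convert hz' using 1 <;> ring
      refine h6.shift.congr_field (ae_of_all _ fun t ht => ?_)
      simp only [sub_eq_add_neg, if_neg ht.1.not_gt]
    · simpa using hz''S
  · dsimp only
    -- The first branch is possible only for `s = 0`, where the two pieces agree.
    split_ifs with h7
    · have : s = 0 := le_antisymm (by linarith) hs
      rw [this, add_zero, hz''S, ← hz's, this]
    · rw [add_sub_cancel_left, hz's]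
  · simpa using hs

/-- Inputs which agree on growing time intervals have a common extension. -/
theorem exists_common_input {w : ℕ → ℝ → W} {S : ℕ → ℝ} (hr : 0 ≤ r)
    (hw : ∀ k, IsBoundedInput r (w k)) (hS : Monotone S)
    (hagree : ∀ k, ∀ t < S k, w (k + 1) t = w k t) :
    ∃ w' : ℝ → W, IsBoundedInput r w' ∧ ∀ k, ∀ t < S k, w' t = w k t := by
  classical
  have hag : ∀ j k, j ≤ k → ∀ t < S j, w k t = w j t := by
    intro j k hjk
    induction k, hjk using Nat.le_induction with
    | base => exact fun t _ => rfl
    | succ k hjk ih => exact fun t ht => (hagree k t (ht.trans_le (hS hjk))).trans (ih t ht)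
  let w' : ℝ → W := fun t => if h : ∃ k, t < S k then w (Nat.find h) t else 0
  have hw' : ∀ k, ∀ t < S k, w' t = w k t := by
    intro k t ht
    have h : ∃ k, t < S k := ⟨k, ht⟩
    simp only [w', dif_pos h]
    exact (hag _ _ (Nat.find_min' h ht) t (Nat.find_spec h)).symm
  refine ⟨w', ⟨?_, fun t => ?_⟩, hw'⟩
  -- The restrictions of `w k` to `t < S k`, extended by zero, converge pointwise to the common
  -- input.
  · refine stronglyMeasurable_of_tendsto atTop
      (fun k => (hw k).1.indicator (measurableSet_Iio (a := S k))) (tendsto_pi_nhds.2 fun t => ?_)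
    refine tendsto_const_nhds.congr' ?_
    by_cases h : ∃ k, t < S k
    · obtain ⟨k, hk⟩ := h
      filter_upwards [eventually_ge_atTop k] with j hj
      have htj : t < S j := hk.trans_le (hS hj)
      rw [indicator_of_mem (show t ∈ Iio (S j) from htj), hw' j t htj]
    · refine Eventually.of_forall fun j => ?_
      have hj : t ∉ Iio (S j) := fun hj => h ⟨j, hj⟩
      simp only [w', dif_neg h, indicator_of_notMem hj]
  · simp only [w']
    split_ifs
    exacts [(hw _).2 t, by simpa using hr]

/-- If every bounded input admits global trajectories from every initial point, then no point is
close to trajectories with bounded inputs that are unbounded in finite time. -/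
theorem not_unboundedNear [ProperSpace E] [ProperSpace W] (hg : Continuous g)
    (hL : LipOnBalls g) (hr : 0 ≤ r)
    (hFC : ∀ (x : E) (w : ℝ → W), IsBoundedInput r w →
      ∃ z : ℝ → E, z 0 = x ∧ ∀ T, IsTraj g w 0 T z) (c : E) : ¬ UnboundedNear g r T c := by
  intro hc
  have hp₀ : ReachesUnbounded g r (T + 1) c (fun _ => 0, 0, c, T) :=
    ⟨⟨stronglyMeasurable_const, fun t => by simpa using hr⟩, le_rfl, by simp, hc,
      fun _ => c, by simp, ⟨continuousOn_const, by simp, fun t ht => by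
        obtain rfl : t = 0 := le_antisymm ht.2 ht.1
        simp⟩, rfl⟩
  choose F hF hFS hFw hFx using
    fun p : {p // ReachesUnbounded g r (T + 1) c p} => p.2.exists_next hg hL
  let P : ℕ → {p // ReachesUnbounded g r (T + 1) c p} := fun k =>
    Nat.rec ⟨_, hp₀⟩ (fun _ p => ⟨F p, hF p⟩) k
  have hnorm : ∀ k : ℕ, (k : ℝ) ≤ ‖(P k).1.2.2.1‖ := by
    intro k
    induction k with
    | zero => simp
    | succ k ih =>
      push_cast
      exact (add_le_add_left ih 1).trans (hFx (P k)).ge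
  have hmono : Monotone fun k => (P k).1.2.1 := monotone_nat_of_le_succ fun k => hFS (P k)
  -- Successive inputs are unchanged before the times already reached, so one input drives all the
  -- trajectories.
  obtain ⟨w, hw, hwP⟩ := exists_common_input hr (fun k => (P k).2.input) hmono
    fun k => hFw (P k)
  have hST : ∀ k, (P k).1.2.1 ∈ Icc 0 (T + 1) := fun k =>
    ⟨(P k).2.nonneg, by linarith [(P k).2.lt, (P k).2.unbounded.nonneg]⟩
  choose y hy0 hy hyS using fun k => (P k).2.traj
  have hyw : ∀ k, IsTraj g w 0 (P k).1.2.1 (y k) := fun k => by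
    refine (hy k).congr_field ?_
    filter_upwards [Measure.ae_ne volume (P k).1.2.1] with t ht htS
    rw [hwP k t (lt_of_le_of_ne htS.2 ht)]
  obtain ⟨η, -, φ, hφ, hlim⟩ := (isCompact_closedBall c 1).tendsto_subseq
    (x := fun k => y k 0) fun k => mem_closedBall_iff_norm.2 (hy0 k).le
  -- Completeness is used once, for the cluster point `η` of the initial points. Trajectories
  -- starting near `η` stay below `R + 1`, while the `k`-th one reaches norm at least `k`.
  obtain ⟨z, hz0, hz⟩ := hFC η w hw
  obtain ⟨R, hR⟩ := isCompact_Icc.exists_bound_of_continuousOn (hz (T + 1)).continuousOn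
  have hR0 : 0 ≤ R := (norm_nonneg _).trans (hR 0 ⟨le_rfl, (hST 0).1.trans (hST 0).2⟩)
  obtain ⟨C, hC, hnear⟩ := exists_isTraj_initial_near hg hL r (T + 1) hR0
  have e1 := Metric.tendsto_nhds.1 hlim (1 / C) (by positivity)
  have e2 := (tendsto_natCast_atTop_atTop.comp hφ.tendsto_atTop).eventually_gt_atTop (R + 1)
  obtain ⟨k, h1, h2⟩ := (e1.and e2).exists
  rw [Function.comp_apply, dist_eq_norm, lt_div_iff₀ hC, ← hz0] at h1
  set S := (P (φ k)).1.2.1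
  obtain ⟨y', hy'0, hy', hy'R⟩ := hnear w hw S (hST _) z ((hz (T + 1)).mono le_rfl (hST _).2)
    (fun t ht => hR t ⟨ht.1, ht.2.trans (hST _).2⟩) (y (φ k) 0) (by linarith)
  have hS : S ∈ Icc 0 S := ⟨(hST _).1, le_rfl⟩
  have h3 := hy'R S hS
  rw [hy'.eqOn hL (hw.memLp _ _) (hyw (φ k)) hy'0 hS, hyS] at h3
  have h4 := hnorm (φ k)
  simp only [Function.comp_apply] at h2
  linarith

/-- If bounded inputs admit global trajectories, then trajectories with bounded initial values and
bounded inputs are bounded in bounded time. -/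
theorem exists_bound_of_forward_complete [ProperSpace E] [ProperSpace W] (hg : Continuous g)
    (hL : LipOnBalls g) (hr : 0 ≤ r) (T : ℝ)
    (hFC : ∀ (x : E) (w : ℝ → W), IsBoundedInput r w →
      ∃ z : ℝ → E, z 0 = x ∧ ∀ T, IsTraj g w 0 T z) :
    ∃ C : ℝ, ∀ w : ℝ → W, IsBoundedInput r w → ∀ z : ℝ → E, ‖z 0‖ ≤ r → ∀ t ∈ Icc 0 T,
      IsTraj g w 0 t z → ‖z t‖ ≤ C := by
  by_contra! hcon
  choose w hw z hz0 t ht hz hzt using fun j : ℕ => hcon j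
  obtain ⟨x, -, φ, hφ, hlim⟩ := (isCompact_closedBall (0 : E) r).tendsto_subseq
    (x := fun k => z k 0) fun k => mem_closedBall_zero_iff.2 (hz0 k)
  refine not_unboundedNear (T := T) hg hL hr hFC x fun ε hε N => ?_
  have e1 := Metric.tendsto_nhds.1 hlim ε hε
  have e2 := (tendsto_natCast_atTop_atTop.comp hφ.tendsto_atTop).eventually_ge_atTop N
  obtain ⟨k, h1, h2⟩ := (e1.and e2).exists
  exact ⟨w (φ k), hw _, z (φ k), t (φ k), by simpa [dist_eq_norm] using h1, (ht _).1,
    by linarith [(ht (φ k)).2], hz _, h2.trans (hzt _).le⟩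

end BoundedReachability

/-! ### From the hypotheses on `f` and Carathéodory solutions to trajectories -/

section Bridge

set_option linter.unusedSectionVars false

/-- Uniformity in `u ∈ K` says that `q ↦ f (q, ·)` is locally Lipschitz into `C(K, ℝ^n)`, and a
locally Lipschitz map is Lipschitz on the compact ball. -/
theorem LocLipschitzUniformlyOn.lipOnBalls {n m p : ℕ} {f : Field n m p} (hf : Continuous f)
    (hL : ∀ K : Set (Vec m), IsCompact K → LocLipschitzUniformlyOn f K) :
    LipOnBalls (W := (Fin p → Vec n) × Vec m) f := by
  intro R
  set K := Metric.closedBall (0 : Vec m) R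
  have hK : IsCompact K := isCompact_closedBall _ _
  have : CompactSpace K := isCompact_iff_compactSpace.1 hK
  let Φ : Vec n × (Fin p → Vec n) → C(K, Vec n) := fun q =>
    ⟨fun u => f (q.1, q.2, u), hf.comp (by fun_prop)⟩
  have hΦ : LocallyLipschitz Φ := by
    intro q
    obtain ⟨N, hN, L, hNL⟩ := hL K hK q
    refine ⟨L, N, hN, LipschitzOnWith.of_dist_le_mul fun y hy y' hy' => ?_⟩
    rw [ContinuousMap.dist_le (by positivity)]
    exact fun u => (hNL u u.2).dist_le_mul y hy y' hy'
  obtain ⟨L, hLΦ⟩ := (hΦ.locallyLipschitzOn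
    (s := Metric.closedBall 0 R)).exists_lipschitzOnWith_of_compact (isCompact_closedBall _ _)
  refine ⟨L, fun w hw => LipschitzOnWith.of_dist_le_mul fun x hx y hy => ?_⟩
  have hw1 : ‖w.1‖ ≤ R := (norm_fst_le w).trans hw
  have hw2 : ‖w.2‖ ≤ R := (norm_snd_le w).trans hw
  have hmem : ∀ x ∈ Metric.closedBall (0 : Vec n) R,
      (x, w.1) ∈ Metric.closedBall (0 : Vec n × (Fin p → Vec n)) R := fun x hx => by
    rw [mem_closedBall_zero_iff] at hx ⊢
    exact max_le hx hw1
  have h1 := hLΦ.dist_le_mul (x, w.1) (hmem x hx) (y, w.1) (hmem y hy)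
  rw [Prod.dist_eq, dist_self, max_eq_left dist_nonneg] at h1
  exact (ContinuousMap.dist_apply_le_dist (f := Φ (x, w.1)) (g := Φ (y, w.1))
    ⟨w.2, mem_closedBall_zero_iff.2 hw2⟩).trans h1

theorem memLp_top_prodMk {V U : Type*} [NormedAddCommGroup V] [NormedAddCommGroup U]
    {v : ℝ → V} {u : ℝ → U} {S : Set ℝ} (hS : MeasurableSet S)
    (hv : MemLp v ∞ (volume.restrict S)) (hu : MemLp u ∞ (volume.restrict S)) :
    MemLp (fun s => (v s, u s)) ∞ (volume.restrict S) := by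
  obtain ⟨r, -, hr⟩ := hv.exists_ae_norm_le_on hS
  obtain ⟨r', -, hr'⟩ := hu.exists_ae_norm_le_on hS
  refine memLp_top_of_ae_norm_le (r := max r r') hS (hv.1.prodMk hu.1) ?_
  filter_upwards [hr, hr'] with s hs hs' hsS
  exact max_le_max (hs hsS) (hs' hsS)

theorem memLp_Icc_of_mem_inputs {m : ℕ} {u : ℝ → Vec m} (hu : u ∈ inputs m) (T : ℝ) :
    MemLp u ∞ (volume.restrict (Icc 0 T)) := by
  rw [← restrict_Ioo_eq_restrict_Icc]
  exact hu T

theorem mem_inputs_of_memLp_Icc {m : ℕ} {u : ℝ → Vec m}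
    (hu : ∀ T, MemLp u ∞ (volume.restrict (Icc 0 T))) : u ∈ inputs m := fun T => by
  rw [restrict_Ioo_eq_restrict_Icc]
  exact hu T

theorem memLp_input {n m p : ℕ} {v : ℝ → Fin p → Vec n} {u : ℝ → Vec m}
    (hv : v ∈ delayInputsLinf n p) (hu : u ∈ inputs m) (T : ℝ) :
    MemLp (fun s => (v s, u s)) ∞ (volume.restrict (Icc 0 T)) :=
  memLp_top_prodMk measurableSet_Icc (hv T) (memLp_Icc_of_mem_inputs hu T)

variable {E W : Type*} [NormedAddCommGroup E] [NormedSpace ℝ E] [NormedAddCommGroup W]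
  {g : E × W → E} {w : ℝ → W} {a b : ℝ} {z : ℝ → E}

theorem lipschitzOnWith_integral {h : ℝ → E} {M : NNReal} (hi : IntegrableOn h (Icc a b))
    (hM : ∀ᵐ s, s ∈ Icc a b → ‖h s‖ ≤ M) :
    LipschitzOnWith M (fun t => ∫ s in a..t, h s) (Icc a b) := by
  refine LipschitzOnWith.of_dist_le_mul fun t ht t' ht' => ?_
  have ha : a ∈ Icc a b := ⟨le_rfl, ht.1.trans ht.2⟩
  have hii : ∀ t ∈ Icc a b, IntervalIntegrable h volume a t := fun t ht =>
    (hi.mono_set ((convex_Icc a b).ordConnected.uIcc_subset ha ht)).intervalIntegrable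
  rw [dist_eq_norm, intervalIntegral.integral_interval_sub_left (hii t ht) (hii t' ht'),
    Real.dist_eq]
  refine intervalIntegral.norm_integral_le_of_norm_le_const_ae ?_
  filter_upwards [hM] with s hs hst
  exact hs ((convex_Icc a b).ordConnected.uIcc_subset ht' ht (uIoc_subset_uIcc hst))

theorem IsTraj.absolutelyContinuousOnInterval [ProperSpace E] [ProperSpace W] (hg : Continuous g)
    (hw : MemLp w ∞ (volume.restrict (Icc a b))) (h : IsTraj g w a b z) (hab : a ≤ b) :
    AbsolutelyContinuousOnInterval z a b := by
  obtain ⟨M, hM⟩ := exists_ae_norm_field_le hg hw h.continuousOn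
  have h1 := lipschitzOnWith_integral h.integrableOn hM
  refine LipschitzOnWith.absolutelyContinuousOnInterval (K := M) ?_
  rw [uIcc_of_le hab]
  refine LipschitzOnWith.of_dist_le_mul fun t ht t' ht' => ?_
  rw [h.eq_add_integral t ht, h.eq_add_integral t' ht', dist_add_left]
  exact h1.dist_le_mul t ht t' ht'

theorem IsTraj.ae_hasDerivAt [CompleteSpace E] (h : IsTraj g w a b z) :
    ∀ᵐ t, t ∈ Ioo a b → HasDerivAt z (g (z t, w t)) t := by
  rcases lt_or_ge b a with hba | hab
  · exact ae_of_all _ fun t ht => absurd (ht.1.trans ht.2) hba.not_gt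
  have hi := h.intervalIntegrable (c := a) (d := b) ⟨le_rfl, hab⟩ ⟨hab, le_rfl⟩
  filter_upwards [hi.ae_hasDerivAt_integral] with t ht htm
  have ht' : t ∈ uIcc a b := by rw [uIcc_of_le hab]; exact Ioo_subset_Icc_self htm
  refine ((ht ht' a left_mem_uIcc).const_add (z a)).congr_of_eventuallyEq ?_
  filter_upwards [Ioo_mem_nhds htm.1 htm.2] with s hs
  exact h.eq_add_integral s (Ioo_subset_Icc_self hs)

theorem continuousOn_Ici_of_forall_Icc {E : Type*} [TopologicalSpace E] {z : ℝ → E}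
    (h : ∀ T, ContinuousOn z (Icc 0 T)) : ContinuousOn z (Ici 0) := by
  intro t ht
  refine (h (t + 1) t ⟨ht, by linarith⟩).mono_of_mem_nhdsWithin ?_
  rw [← Ici_inter_Iic]
  exact inter_mem_nhdsWithin _ (Iic_mem_nhds (lt_add_one t))

theorem timeInterval_top : timeInterval ⊤ = Ici 0 := by
  ext t
  simp [timeInterval, EReal.coe_lt_top]

/-- In one direction, `z` minus the primitive of the field is absolutely continuous with zero
derivative almost everywhere, hence constant. In the other, the field is essentially bounded along
`z`, so `z` is Lipschitz on compact intervals, and Lebesgue differentiation gives the derivative. -/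
theorem hasAEDerivOn_top_iff {n : ℕ} {g : Vec n × W → Vec n} [ProperSpace W] {z : ℝ → Vec n}
    (hg : Continuous g) (hw : ∀ T, MemLp w ∞ (volume.restrict (Icc 0 T))) :
    HasAEDerivOn ⊤ z (fun t => g (z t, w t)) ↔ ∀ T, IsTraj g w 0 T z := by
  refine ⟨fun ⟨hc, hac, hd⟩ T => ?_, fun h => ⟨?_, fun a b ha hab _ => ?_, ?_⟩⟩
  · rw [timeInterval_top] at hc
    have hcT : ContinuousOn z (Icc 0 T) := hc.mono Icc_subset_Ici_self
    have hi := integrableOn_field hg (hw T) hcT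
    refine ⟨hcT, hi, fun t ht => ?_⟩
    have hT : 0 ≤ T := ht.1.trans ht.2
    obtain ⟨M, hM⟩ := exists_ae_norm_field_le hg (hw T) hcT
    have hii : IntervalIntegrable (fun s => g (z s, w s)) volume 0 T :=
      IntegrableOn.intervalIntegrable (by rwa [uIcc_of_le hT])
    have hlip := lipschitzOnWith_integral hi hM
    rw [← uIcc_of_le hT] at hlip
    obtain ⟨C, hC⟩ := ((hac 0 T le_rfl hT (EReal.coe_lt_top T)).sub
      hlip.absolutelyContinuousOnInterval).const_of_ae_hasDerivAt_zero (by
        filter_upwards [hd, hii.ae_hasDerivAt_integral, Measure.ae_ne volume 0] with s h1 h2 h3 hs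
        have hs' := hs
        rw [uIcc_of_le hT] at hs'
        have := (h1 (lt_of_le_of_ne hs'.1 (Ne.symm h3)) (EReal.coe_lt_top s)).sub
          (h2 hs 0 left_mem_uIcc)
        rwa [sub_self] at this)
    have e1 := hC 0 left_mem_uIcc
    have e2 := hC t (by rwa [uIcc_of_le hT])
    simp only [Pi.sub_apply, intervalIntegral.integral_same, sub_zero] at e1 e2
    rw [e1, ← e2, sub_add_cancel]
  · rw [timeInterval_top]
    exact continuousOn_Ici_of_forall_Icc fun T => (h T).continuousOn
  · exact ((h b).mono ha le_rfl).absolutelyContinuousOnInterval hg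
      ((hw b).mono_measure (Measure.restrict_mono_set _ (Icc_subset_Icc_left ha))) hab
  · have h1 : ∀ᵐ t, ∀ N : ℕ, t ∈ Ioo 0 (N : ℝ) → HasDerivAt z (g (z t, w t)) t :=
      ae_all_iff.2 fun N => (h N).ae_hasDerivAt
    filter_upwards [h1] with t ht ht0 _
    obtain ⟨N, hN⟩ := exists_nat_gt t
    exact ht N ⟨ht0, hN⟩

/-- Solutions of the ordinary differential equation are global trajectories. -/
theorem isODESolution_top_iff {n m p : ℕ} {f : Field n m p} (hf : Continuous f) {z₀ : Vec n}
    {v : ℝ → Fin p → Vec n} {u : ℝ → Vec m} {z : ℝ → Vec n}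
    (hw : ∀ T, MemLp (fun s => (v s, u s)) ∞ (volume.restrict (Icc 0 T))) :
    IsODESolution f ⊤ z₀ v u z ↔ z 0 = z₀ ∧ ∀ T, IsTraj f (fun s => (v s, u s)) 0 T z :=
  and_congr_right' (hasAEDerivOn_top_iff (W := (Fin p → Vec n) × Vec m) (g := f)
    (w := fun s => (v s, u s)) hf hw)

end Bridge

/-! ### Representatives and continuous approximation of bounded inputs -/

section InputNorms

variable {V : Type*} [NormedAddCommGroup V] {v : ℝ → V} {r : ℝ}

theorem ae_norm_le_of_inputNorm_le (hr : 0 ≤ r) (h : inputNorm v ≤ ENNReal.ofReal r) :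
    ∀ᵐ s : ℝ, 0 < s → ‖v s‖ ≤ r := by
  rw [inputNorm, eLpNorm_exponent_top] at h
  have h1 := ae_le_eLpNormEssSup (f := v) (μ := volume.restrict (Ioi (0 : ℝ)))
  filter_upwards [(ae_restrict_iff' measurableSet_Ioi).1 h1] with s hs h0
  have h2 := (hs h0).trans h
  rwa [← ofReal_norm, ENNReal.ofReal_le_ofReal_iff hr] at h2

theorem inputNorm_le_of_ae_norm_le (h : ∀ᵐ s : ℝ, 0 < s → ‖v s‖ ≤ r) :
    inputNorm v ≤ ENNReal.ofReal r := by
  rw [inputNorm, eLpNorm_exponent_top]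
  exact eLpNormEssSup_le_of_ae_bound ((ae_restrict_iff' measurableSet_Ioi).2 h)

theorem ae_norm_le_Icc_of_Ioi (h : ∀ᵐ s : ℝ, 0 < s → ‖v s‖ ≤ r) (T : ℝ) :
    ∀ᵐ s, s ∈ Icc 0 T → ‖v s‖ ≤ r := by
  filter_upwards [h, Measure.ae_ne volume 0] with s h1 h2 h3
  exact h1 (lt_of_le_of_ne h3.1 (Ne.symm h2))

/-- A measurable representative, set to zero wherever it exceeds `r`, is bounded at every time, so
that later arguments need no exceptional null sets. -/
theorem exists_isBoundedInput_ae_eq {a b : ℝ} (hr : 0 ≤ r)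
    (hv : AEStronglyMeasurable v (volume.restrict (Icc a b)))
    (h : ∀ᵐ s, s ∈ Icc a b → ‖v s‖ ≤ r) :
    ∃ v' : ℝ → V, IsBoundedInput r v' ∧ ∀ᵐ s, s ∈ Icc a b → v s = v' s := by
  refine ⟨{s | ‖hv.mk v s‖ ≤ r}.indicator (hv.mk v), ⟨hv.stronglyMeasurable_mk.indicator
    (hv.stronglyMeasurable_mk.norm.measurable measurableSet_Iic), fun s => ?_⟩, ?_⟩
  · by_cases hs : s ∈ {s | ‖hv.mk v s‖ ≤ r}
    · rw [indicator_of_mem hs]; exact hs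
    · rw [indicator_of_notMem hs, norm_zero]; exact hr
  · filter_upwards [h, (ae_restrict_iff' measurableSet_Icc).1 hv.ae_eq_mk] with s h1 h2 hs
    rw [indicator_of_mem, h2 hs]
    rw [mem_ofPred_eq, ← h2 hs]
    exact h1 hs

/-- Averages over `[t, t + 1 / (j + 1)]` are continuous, keep the bound `r`, and converge almost
everywhere by Lebesgue differentiation. -/
theorem exists_continuous_approx [NormedSpace ℝ V] [CompleteSpace V] (hv : MemLp v ∞ volume)
    (hr : ∀ s, ‖v s‖ ≤ r) :
    ∃ φ : ℕ → ℝ → V, (∀ j, Continuous (φ j)) ∧ (∀ j t, ‖φ j t‖ ≤ r) ∧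
      ∀ᵐ t, Tendsto (fun j => φ j t) atTop (𝓝 (v t)) := by
  have hloc : LocallyIntegrable v volume := hv.locallyIntegrable le_top
  have hii : ∀ a b, IntervalIntegrable v volume a b := fun a b =>
    (hloc.integrableOn_isCompact isCompact_uIcc).intervalIntegrable
  have hpos : ∀ j : ℕ, (0 : ℝ) < 1 / ((j : ℝ) + 1) := fun j => by positivity
  refine ⟨fun j t => (1 / ((j : ℝ) + 1))⁻¹ •
    ((∫ s in (0 : ℝ)..(t + 1 / ((j : ℝ) + 1)), v s) - ∫ s in (0 : ℝ)..t, v s), fun j => ?_,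
    fun j t => ?_, ?_⟩
  · have := intervalIntegral.continuous_primitive hii 0
    exact ((this.comp (continuous_add_const _)).sub this).const_smul _
  · dsimp only
    rw [intervalIntegral.integral_interval_sub_left (hii _ _) (hii _ _), norm_smul, norm_inv,
      Real.norm_of_nonneg (hpos j).le, inv_mul_le_iff₀ (hpos j)]
    have := intervalIntegral.norm_integral_le_of_norm_le_const (f := v) (a := t)
      (b := t + 1 / ((j : ℝ) + 1)) fun s _ => hr s
    rwa [add_sub_cancel_left, abs_of_pos (hpos j), mul_comm] at this
  · filter_upwards [_root_.LocallyIntegrable.ae_hasDerivAt_integral hloc] with t ht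
    refine (ht 0).tendsto_slope_zero.comp (tendsto_nhdsWithin_iff.2
      ⟨tendsto_one_div_add_atTop_nhds_zero_nat, Eventually.of_forall fun j => (hpos j).ne'⟩)

end InputNorms

/-! ### Continuous and measurable delay-inputs of the ordinary differential equation -/

section ODE

variable {n m p : ℕ} {f : Field n m p} {r : ℝ}

theorem delayInputsC0_subset_delayInputsLinf : delayInputsC0 n p ⊆ delayInputsLinf n p := by
  intro v hv T
  have hc : ContinuousOn v (Icc 0 T) := ContinuousOn.mono hv Icc_subset_Ici_self
  obtain ⟨C, hC⟩ := isCompact_Icc.exists_bound_of_continuousOn hc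
  exact memLp_top_of_ae_norm_le measurableSet_Icc (hc.aestronglyMeasurable measurableSet_Icc)
    (ae_of_all _ hC)

theorem IsBoundedInput.fst_mem {w : ℝ → (Fin p → Vec n) × Vec m} (hw : IsBoundedInput r w) :
    (fun s => (w s).1) ∈ delayInputsLinf n p := fun _ =>
  memLp_top_of_bound (hw.1.fst).aestronglyMeasurable r
    (ae_of_all _ fun s => (norm_fst_le _).trans (hw.2 s))

theorem IsBoundedInput.snd_mem {w : ℝ → (Fin p → Vec n) × Vec m} (hw : IsBoundedInput r w) :
    (fun s => (w s).2) ∈ inputs m := fun _ =>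
  memLp_top_of_bound (hw.1.snd).aestronglyMeasurable r
    (ae_of_all _ fun s => (norm_snd_le _).trans (hw.2 s))

theorem ODEForwardComplete.exists_isTraj (hf : Continuous f)
    (h : ODEForwardComplete f (delayInputsLinf n p)) (x : Vec n)
    (w : ℝ → (Fin p → Vec n) × Vec m) (hw : IsBoundedInput r w) :
    ∃ z : ℝ → Vec n, z 0 = x ∧ ∀ T, IsTraj f w 0 T z := by
  obtain ⟨z, hz⟩ := h x _ hw.fst_mem _ hw.snd_mem
  exact ⟨z, (isODESolution_top_iff hf (memLp_input hw.fst_mem hw.snd_mem)).1 hz⟩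

/-- A bound for the trajectories with inputs bounded by `r` gives bounded reachability sets. -/
theorem odeBoundedReach_of_bound (hf : Continuous f)
    (h : ODEForwardComplete f (delayInputsLinf n p))
    (hC : ∀ r : ℝ, 0 < r → ∃ C : ℝ, ∀ w : ℝ → (Fin p → Vec n) × Vec m, IsBoundedInput r w →
      ∀ z : ℝ → Vec n, ‖z 0‖ ≤ r → ∀ t ∈ Icc 0 r, IsTraj f w 0 t z → ‖z t‖ ≤ C) :
    ODEBoundedReach f (delayInputsLinf n p) := by
  refine ⟨h, fun r hr => ?_⟩
  obtain ⟨C, hC⟩ := hC r hr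
  refine (Metric.isBounded_closedBall (x := (0 : Vec n)) (r := C)).subset ?_
  rintro ξ ⟨t, ht, z₀, v, hv, u, hu, z, hz₀, hvr, hur, hz, rfl⟩
  obtain ⟨hz0, hz⟩ := (isODESolution_top_iff hf (memLp_input hv hu)).1 hz
  have hv' := ae_norm_le_Icc_of_Ioi (ae_norm_le_of_inputNorm_le hr.le hvr) t
  have hu' := ae_norm_le_Icc_of_Ioi (ae_norm_le_of_inputNorm_le hr.le hur) t
  obtain ⟨w, hw, hweq⟩ := exists_isBoundedInput_ae_eq hr.le (memLp_input hv hu t).1 (by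
    filter_upwards [hv', hu'] with s h1 h2 h3
    exact max_le (h1 h3) (h2 h3))
  rw [mem_closedBall_zero_iff]
  refine hC w hw z (by rwa [hz0]) t ht ((hz t).congr_field ?_)
  filter_upwards [hweq] with s hs hst
  rw [hs hst]

theorem ODEForwardComplete.boundedReach (hf : Continuous f)
    (hL : LipOnBalls (W := (Fin p → Vec n) × Vec m) f)
    (h : ODEForwardComplete f (delayInputsLinf n p)) : ODEBoundedReach f (delayInputsLinf n p) :=
  odeBoundedReach_of_bound hf h fun r hr =>
    exists_bound_of_forward_complete hf hL hr.le r fun x w hw => h.exists_isTraj hf x w hw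

/-- If continuous delay-inputs give bounded reachability sets, then so do measurable ones, with the
same bound. -/
theorem ODEBoundedReach.exists_isTraj_le (hf : Continuous f)
    (hL : LipOnBalls (W := (Fin p → Vec n) × Vec m) f)
    (h : ODEBoundedReach f (delayInputsC0 n p)) (hr : 0 < r) :
    ∃ C : ℝ, ∀ w : ℝ → (Fin p → Vec n) × Vec m, IsBoundedInput r w → ∀ x : Vec n, ‖x‖ ≤ r →
      ∃ z : ℝ → Vec n, z 0 = x ∧ IsTraj f w 0 r z ∧ ∀ t ∈ Icc 0 r, ‖z t‖ ≤ C := by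
  obtain ⟨C, hC⟩ := (h.2 r hr).exists_norm_le
  refine ⟨C, fun w hw x hx => ?_⟩
  -- Only the delay-input is smoothed; `u` may stay measurable.
  obtain ⟨φ, hφc, hφr, hφlim⟩ := exists_continuous_approx (v := fun s => (w s).1) (r := r)
    (memLp_top_of_bound (hw.1.fst).aestronglyMeasurable r
      (ae_of_all _ fun s => (norm_fst_le _).trans (hw.2 s)))
    (fun s => (norm_fst_le _).trans (hw.2 s))
  have hφmem : ∀ j, φ j ∈ delayInputsC0 n p := fun j => (hφc j).continuousOn
  have hwj : ∀ j T, MemLp (fun s => (φ j s, (w s).2)) ∞ (volume.restrict (Icc 0 T)) := fun j =>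
    memLp_input (delayInputsC0_subset_delayInputsLinf (hφmem j)) hw.snd_mem
  have hwjr : ∀ j s, ‖(φ j s, (w s).2)‖ ≤ r := fun j s =>
    max_le (hφr j s) ((norm_snd_le (w s)).trans (hw.2 s))
  choose y hyS using fun j => h.1 x (φ j) (hφmem j) _ hw.snd_mem
  have hyC : ∀ j, ∀ t ∈ Icc 0 r, ‖y j t‖ ≤ C := fun j t ht =>
    hC _ ⟨t, ht, x, φ j, hφmem j, _, hw.snd_mem, y j, hx,
      inputNorm_le_of_ae_norm_le (ae_of_all _ fun s _ => hφr j s),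
      inputNorm_le_of_ae_norm_le (ae_of_all _ fun s _ => (norm_snd_le _).trans (hw.2 s)), hyS j,
      rfl⟩
  have hy := fun j => (isODESolution_top_iff hf (hwj j)).1 (hyS j)
  have hC0 : 0 ≤ C := (norm_nonneg _).trans (hyC 0 0 ⟨le_rfl, hr.le⟩)
  have hR : 0 < C + 1 := by linarith
  obtain ⟨K, hK⟩ := hL.cutoff hR r
  have hcont := continuous_cutoff hR hf
  obtain ⟨M, hM⟩ := ((isCompact_closedBall (0 : Vec n) (C + 1)).prod
    (isCompact_closedBall (0 : (Fin p → Vec n) × Vec m) r)).exists_bound_of_continuousOn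
    hf.continuousOn
  have hMc : ∀ x w, ‖w‖ ≤ r → ‖cutoff (W := (Fin p → Vec n) × Vec m) f (C + 1) (x, w)‖ ≤ M :=
    fun x w hw => hM _ ⟨mem_closedBall_zero_iff.2 (norm_radialRetraction_le hR x),
      mem_closedBall_zero_iff.2 hw⟩
  -- A solution under the limit input is so far available only for the field truncated at `C + 1`;
  -- the approximants `y j` never leave the ball of radius `C`.
  obtain ⟨z, hz0, hz⟩ := exists_isTraj_of_lipschitz hcont hK (hw.memLp 0 r)
    (ae_of_all _ fun s _ => hw.2 s) x
  set G : Vec n × ((Fin p → Vec n) × Vec m) → Vec n := cutoff f (C + 1)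
  -- The error is measured along the fixed curve `z`, so it tends to zero pointwise almost
  -- everywhere, dominated by `2 * M`.
  let e : ℕ → ℝ → ℝ := fun j s => ‖G (z s, (φ j s, (w s).2)) - G (z s, w s)‖
  have hei : ∀ j, IntegrableOn (e j) (Icc 0 r) := fun j =>
    ((integrableOn_field hcont (hwj j r) hz.continuousOn).sub hz.integrableOn).norm
  have helim : Tendsto (fun j => ∫ s in Icc 0 r, e j s) atTop (𝓝 0) := by
    suffices h : Tendsto (fun j => ∫ s in Icc 0 r, e j s) atTop
        (𝓝 (∫ s in Icc 0 r, (fun _ => (0 : ℝ)) s)) by simpa only [integral_zero] using h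
    refine tendsto_integral_of_dominated_convergence (fun _ => 2 * M)
      (fun j => (hei j).aestronglyMeasurable) (integrable_const _) (fun j => ?_) ?_
    · refine ae_of_all _ fun s => ?_
      rw [Real.norm_of_nonneg (norm_nonneg _)]
      refine (norm_sub_le _ _).trans ?_
      linarith [hMc (z s) _ (hwjr j s), hMc (z s) _ (hw.2 s)]
    · refine ae_restrict_of_ae ?_
      filter_upwards [hφlim] with s hs
      have h1 : Tendsto (fun j => G (z s, (φ j s, (w s).2))) atTop (𝓝 (G (z s, w s))) :=
        (hcont.tendsto _).comp (tendsto_const_nhds.prodMk_nhds (hs.prodMk_nhds tendsto_const_nhds))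
      simpa using (h1.sub_const (G (z s, w s))).norm
  -- Grönwall's inequality bounds `z - y j` by the integral of `e j`; in the limit `z` inherits the
  -- bound `C`, so the truncation was inactive.
  have hzC : ∀ t ∈ Icc 0 r, ‖z t‖ ≤ C := by
    intro t ht
    have h1 : ∀ j, ‖z t‖ ≤ C + (∫ s in Icc 0 r, e j s) * Real.exp (K * (t - 0)) := by
      intro j
      have h2 := IsTraj.norm_sub_le K.2 (((hy j).2 r).cutoff hR fun t ht =>
        (hyC j t ht).trans (by linarith)) hz (hei j) (fun _ => norm_nonneg _) (by
          refine ae_of_all _ fun s _ => ?_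
          refine (norm_sub_le_norm_sub_add_norm_sub _ (G (z s, (φ j s, (w s).2))) _).trans ?_
          refine add_le_add_left ?_ _
          rw [← dist_eq_norm, ← dist_eq_norm]
          exact (hK _ (hwjr j s)).dist_le_mul _ _) t ht
      rw [(hy j).1, hz0, sub_self, norm_zero, zero_add] at h2
      have h3 := norm_le_norm_add_norm_sub (y j t) (z t)
      exact h3.trans (add_le_add (hyC j t ht) h2)
    have h4 := (helim.mul_const (Real.exp (K * (t - 0)))).const_add C
    rw [zero_mul, add_zero] at h4
    exact ge_of_tendsto' h4 h1
  exact ⟨z, hz0, hz.of_cutoff hR fun t ht => (hzC t ht).trans (by linarith), hzC⟩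

theorem odeForwardComplete_of_forall_isTraj {V : Set (ℝ → Fin p → Vec n)} (hf : Continuous f)
    (hL : LipOnBalls (W := (Fin p → Vec n) × Vec m) f) (hV : V ⊆ delayInputsLinf n p)
    (h : ∀ x : Vec n, ∀ v ∈ V, ∀ u ∈ inputs m, ∀ T : ℝ, 0 ≤ T →
      ∃ z : ℝ → Vec n, z 0 = x ∧ IsTraj f (fun s => (v s, u s)) 0 T z) :
    ODEForwardComplete f V := by
  intro x v hv u hu
  have hw := memLp_input (hV hv) hu
  obtain ⟨z, hz⟩ := exists_global_isTraj hL hw (x := x) fun T => by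
    obtain ⟨z, hz0, hz⟩ := h x v hv u hu (max T 0) (le_max_right _ _)
    exact ⟨z, hz0, hz.mono le_rfl (le_max_left _ _)⟩
  exact ⟨z, (isODESolution_top_iff hf hw).2 hz⟩

theorem ODEBoundedReach.linf_of_c0 (hf : Continuous f)
    (hL : LipOnBalls (W := (Fin p → Vec n) × Vec m) f)
    (h : ODEBoundedReach f (delayInputsC0 n p)) : ODEBoundedReach f (delayInputsLinf n p) := by
  refine odeBoundedReach_of_bound hf (odeForwardComplete_of_forall_isTraj hf hL Subset.rfl
    fun x v hv u hu T hT => ?_) fun r hr => ?_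
  · have hw := memLp_input hv hu T
    obtain ⟨r₀, -, hr₀⟩ := hw.exists_ae_norm_le_on measurableSet_Icc
    -- One radius bounds the time, the initial point and the inputs at once, as bounded reachability
    -- requires.
    set r := max (max 1 T) (max ‖x‖ r₀)
    have hr : 0 < r := lt_max_of_lt_left (lt_max_of_lt_left one_pos)
    have hTr : T ≤ r := (le_max_right _ _).trans (le_max_left _ _)
    obtain ⟨w', hw', heq⟩ := exists_isBoundedInput_ae_eq hr.le hw.1 (by
      filter_upwards [hr₀] with s hs hst
      exact (hs hst).trans ((le_max_right _ _).trans (le_max_right _ _)))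
    obtain ⟨C, hC⟩ := h.exists_isTraj_le hf hL hr
    obtain ⟨z, hz0, hz, -⟩ := hC w' hw' x ((le_max_left _ _).trans (le_max_right _ _))
    refine ⟨z, hz0, (hz.mono le_rfl hTr).congr_field ?_⟩
    filter_upwards [heq] with s hs hst
    rw [hs hst]
  · obtain ⟨C, hC⟩ := h.exists_isTraj_le hf hL hr
    refine ⟨C, fun w hw z hz0 t ht hz => ?_⟩
    obtain ⟨y, hy0, hy, hyC⟩ := hC w hw (z 0) hz0
    rw [hz.eqOn hL (hw.memLp _ _) (hy.mono le_rfl ht.2) hy0.symm ⟨ht.1, le_rfl⟩]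
    exact hyC t ht

end ODE

/-! ### Delay-inputs generated by the past of a trajectory -/

section DelayedState

variable {n m p : ℕ} {θ : Fin p → ℝ} {x₀ x : ℝ → Vec n}

/-- The delay-inputs generated by an initial state and a trajectory. -/
noncomputable def delayed (θ : Fin p → ℝ) (x₀ x : ℝ → Vec n) (t : ℝ) (k : Fin p) : Vec n :=
  concat x₀ x (t - θ k)

theorem isTDSSolution_iff {f : Field n m p} {u : ℝ → Vec m} :
    IsTDSSolution f θ ⊤ x₀ u x ↔ IsODESolution f ⊤ (x₀ 0) (delayed θ x₀ x) u x :=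
  Iff.rfl

theorem le_maxDelay (θ : Fin p → ℝ) (k : Fin p) : θ k ≤ maxDelay θ :=
  le_ciSup (Set.finite_range θ).bddAbove k

theorem concat_of_nonneg (h0 : x 0 = x₀ 0) {s : ℝ} (hs : 0 ≤ s) : concat x₀ x s = x s := by
  rcases hs.eq_or_lt with rfl | hs
  · simp [concat, h0]
  · exact if_pos hs

theorem concat_of_nonpos {s : ℝ} (hs : s ≤ 0) : concat x₀ x s = x₀ s := if_neg hs.not_gt

theorem delayed_mem_delayInputsC0 (hx₀ : x₀ ∈ stateC0 n θ) (hx : ContinuousOn x (Ici 0))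
    (h0 : x 0 = x₀ 0) : delayed θ x₀ x ∈ delayInputsC0 n p := by
  have hc : ContinuousOn (concat x₀ x) (Icc (-maxDelay θ) 0 ∪ Ici 0) :=
    ContinuousOn.union_of_isClosed
      (ContinuousOn.congr hx₀ fun s hs => concat_of_nonpos hs.2)
      (hx.congr fun s hs => concat_of_nonneg h0 hs) isClosed_Icc isClosed_Ici
  refine continuousOn_pi.2 fun k => hc.comp (by fun_prop) fun t ht => ?_
  rcases le_total (t - θ k) 0 with h | h
  · exact Or.inl ⟨by linarith [le_maxDelay θ k, mem_Ici.1 ht], h⟩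
  · exact Or.inr h

theorem ae_norm_delayed_le {r T : ℝ} (hx₀ : ∀ᵐ s, s ∈ Icc (-maxDelay θ) 0 → ‖x₀ s‖ ≤ r)
    (hr : 0 ≤ r) (hx : ∀ t ∈ Icc 0 T, ∀ k, 0 < t - θ k → ‖x (t - θ k)‖ ≤ r) :
    ∀ᵐ t, t ∈ Icc 0 T → ‖delayed θ x₀ x t‖ ≤ r := by
  have h1 : ∀ᵐ t : ℝ, ∀ k, t - θ k ∈ Icc (-maxDelay θ) 0 → ‖x₀ (t - θ k)‖ ≤ r :=
    ae_all_iff.2 fun k =>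
      (measurePreserving_sub_right volume (θ k)).quasiMeasurePreserving.ae hx₀
  filter_upwards [h1] with t ht htT
  refine (pi_norm_le_iff_of_nonneg hr).2 fun k => ?_
  rw [delayed, concat]
  split_ifs with hk
  · exact hx t htT k hk
  · exact ht k ⟨by linarith [le_maxDelay θ k, htT.1], not_lt.1 hk⟩

theorem delayed_mem_delayInputsLinf (hθ : ∀ k, 0 ≤ θ k) (hx₀ : x₀ ∈ stateLinf n θ)
    (hx : ContinuousOn x (Ici 0)) : delayed θ x₀ x ∈ delayInputsLinf n p := by
  intro T
  obtain ⟨r, hr, hrx₀⟩ := MemLp.exists_ae_norm_le_on measurableSet_Icc hx₀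
  obtain ⟨R, hR⟩ := isCompact_Icc.exists_bound_of_continuousOn
    (hx.mono (Icc_subset_Ici_self : Icc 0 T ⊆ Ici 0))
  refine memLp_top_of_ae_norm_le (r := max r R) measurableSet_Icc ?_
    (ae_norm_delayed_le (hrx₀.mono fun s hs hsm => (hs hsm).trans (le_max_left _ _))
      (hr.trans (le_max_left _ _)) fun t ht k hk =>
        (hR _ ⟨hk.le, by linarith [ht.2, hθ k]⟩).trans (le_max_right _ _))
  have hm : AEStronglyMeasurable (concat x₀ x)
      (volume.restrict (Icc (-maxDelay θ) 0 ∪ Ioc 0 T)) := by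
    rw [aestronglyMeasurable_union_iff]
    refine ⟨(MemLp.aestronglyMeasurable hx₀).congr ?_,
      ((hx.mono (Ioc_subset_Icc_self.trans Icc_subset_Ici_self)).aestronglyMeasurable
        measurableSet_Ioc).congr ?_⟩
    · exact (ae_restrict_iff' measurableSet_Icc).2
        (ae_of_all _ fun s hs => (concat_of_nonpos hs.2).symm)
    · exact (ae_restrict_iff' measurableSet_Ioc).2 (ae_of_all _ fun s hs => (if_pos hs.1).symm)
  have hk : ∀ k, AEStronglyMeasurable (fun t => delayed θ x₀ x t k) (volume.restrict (Icc 0 T)) := by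
    intro k
    have h1 := (measurePreserving_sub_right volume (θ k)).restrict_preimage
      (s := Icc (-maxDelay θ) 0 ∪ Ioc 0 T) (measurableSet_Icc.union measurableSet_Ioc)
    refine (hm.comp_measurePreserving h1).mono_measure (Measure.restrict_mono_set _ fun t ht => ?_)
    rcases le_or_gt (t - θ k) 0 with h | h
    · exact Or.inl ⟨by linarith [le_maxDelay θ k, ht.1], h⟩
    · exact Or.inr ⟨h, by linarith [ht.2, hθ k]⟩
  exact (aemeasurable_pi_lambda _ fun k => (hk k).aemeasurable).aestronglyMeasurable

theorem stateC0_subset_stateLinf : stateC0 n θ ⊆ stateLinf n θ := by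
  intro x₀ hx₀
  obtain ⟨C, hC⟩ := isCompact_Icc.exists_bound_of_continuousOn hx₀
  exact memLp_top_of_ae_norm_le measurableSet_Icc
    (ContinuousOn.aestronglyMeasurable hx₀ measurableSet_Icc) (ae_of_all _ hC)

theorem maxDelay_nonneg (hθ : ∀ k, 0 ≤ θ k) : 0 ≤ maxDelay θ := Real.iSup_nonneg hθ

theorem normLinf_le_normC0 (hθ : ∀ k, 0 ≤ θ k) (x₀ : ℝ → Vec n) :
    normLinf θ x₀ ≤ normC0 θ x₀ := by
  have h1 : ∀ s ∈ Icc (-maxDelay θ) 0, ‖x₀ s‖ₑ ≤ normC0 θ x₀ := fun s hs =>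
    le_iSup₂ (f := fun s (_ : s ∈ Icc (-maxDelay θ) 0) => ‖x₀ s‖ₑ) s hs
  refine max_le ?_ (h1 0 ⟨by linarith [maxDelay_nonneg hθ], le_rfl⟩)
  rw [eLpNorm_exponent_top]
  exact essSup_le_of_ae_le _ ((ae_restrict_iff' measurableSet_Icc).2 (ae_of_all _ h1))

theorem TDSForwardComplete.mono {f : Field n m p} {X X' : Set (ℝ → Vec n)}
    (h : TDSForwardComplete f θ X') (hX : X ⊆ X') : TDSForwardComplete f θ X :=
  fun x₀ hx₀ u hu => h x₀ (hX hx₀) u hu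

theorem TDSBoundedReach.c0_of_linf {f : Field n m p} (hθ : ∀ k, 0 ≤ θ k)
    (h : TDSBoundedReach f θ (stateLinf n θ) (normLinf θ)) :
    TDSBoundedReach f θ (stateC0 n θ) (normC0 θ) := by
  refine ⟨h.1.mono stateC0_subset_stateLinf, fun r hr => (h.2 r hr).subset ?_⟩
  rintro ξ ⟨t, ht, x₀, hx₀, u, hu, x, h1, h2⟩
  exact ⟨t, ht, x₀, stateC0_subset_stateLinf hx₀, u, hu, x,
    (normLinf_le_normC0 hθ x₀).trans h1, h2⟩

end DelayedState

/-! ### The method of steps: from the equation to the delay system -/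

section MethodOfSteps

variable {n m p : ℕ} {f : Field n m p} {θ : Fin p → ℝ}

theorem exists_pos_forall_le (hθ : ∀ k, 0 < θ k) : ∃ δ > 0, ∀ k, δ ≤ θ k := by
  have h : ∀ᶠ δ in 𝓝[>] (0 : ℝ), ∀ k, δ ≤ θ k :=
    eventually_all.2 fun k => nhdsWithin_le_nhds (Iic_mem_nhds (hθ k))
  obtain ⟨δ, hδ, hδ0⟩ := (h.and self_mem_nhdsWithin).exists
  exact ⟨δ, hδ0, hδ⟩

/-- Forward completeness of the delay system by the method of steps. -/
theorem ODEForwardComplete.tdsForwardComplete (hf : Continuous f)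
    (hL : LipOnBalls (W := (Fin p → Vec n) × Vec m) f) (hθ : ∀ k, 0 < θ k)
    {X : Set (ℝ → Vec n)} {V : Set (ℝ → Fin p → Vec n)} (hV : V ⊆ delayInputsLinf n p)
    (hXV : ∀ x₀ ∈ X, ∀ x : ℝ → Vec n, ContinuousOn x (Ici 0) → x 0 = x₀ 0 → delayed θ x₀ x ∈ V)
    (h : ODEForwardComplete f V) : TDSForwardComplete f θ X := by
  intro x₀ hx₀ u hu
  -- Solving with the delay-inputs of a trial curve gives a new curve on the whole half-line; the
  -- `k`-th iterate is final on `[0, k * δ]`.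
  have hstep : ∀ x : {x : ℝ → Vec n // ContinuousOn x (Ici 0) ∧ x 0 = x₀ 0}, ∃ z : ℝ → Vec n,
      z 0 = x₀ 0 ∧ ∀ T, IsTraj f (fun s => (delayed θ x₀ x.1 s, u s)) 0 T z := fun x => by
    have hv := hXV x₀ hx₀ x.1 x.2.1 x.2.2
    obtain ⟨z, hz⟩ := h (x₀ 0) _ hv u hu
    exact ⟨z, (isODESolution_top_iff hf (memLp_input (hV hv) hu)).1 hz⟩
  choose F hF0 hF using hstep
  let Z : ℕ → {x : ℝ → Vec n // ContinuousOn x (Ici 0) ∧ x 0 = x₀ 0} := fun k =>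
    Nat.rec ⟨fun _ => x₀ 0, continuousOn_const, rfl⟩
      (fun _ x => ⟨F x, continuousOn_Ici_of_forall_Icc fun T => (hF x T).continuousOn, hF0 x⟩) k
  have hZ : ∀ k T, IsTraj f (fun s => (delayed θ x₀ (Z k).1 s, u s)) 0 T (Z (k + 1)).1 :=
    fun k T => hF (Z k) T
  have hZ0 : ∀ k, (Z k).1 0 = x₀ 0 := fun k => (Z k).2.2
  clear_value Z
  obtain ⟨δ, hδ, hδθ⟩ := exists_pos_forall_le hθ
  -- As every delay is at least `δ`, the delay-inputs up to `T + δ` see the curve only up to `T`.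
  -- Each iteration therefore gains a length `δ`.
  have hdel : ∀ (x y : ℝ → Vec n) (T : ℝ), EqOn x y (Icc 0 T) → ∀ t ∈ Icc 0 (T + δ),
      delayed θ x₀ x t = delayed θ x₀ y t := by
    intro x y T hxy t ht
    funext k
    rw [delayed, delayed, concat, concat]
    split_ifs with hk
    · exact hxy ⟨hk.le, by linarith [ht.2, hδθ k]⟩
    · rfl
  have hsucc : ∀ k : ℕ, EqOn (Z (k + 1)).1 (Z k).1 (Icc 0 (k * δ)) := by
    intro k
    induction k with
    | zero =>
      intro t ht
      obtain rfl : t = 0 := le_antisymm (by simpa using ht.2) ht.1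
      rw [hZ0, hZ0]
    | succ k ih =>
      refine IsTraj.eqOn hL (memLp_input (hV (hXV x₀ hx₀ _ (Z k).2.1 (Z k).2.2)) hu _)
        ((hZ (k + 1) _).congr_field (ae_of_all _ fun t ht => ?_)) (hZ k _)
        ((hZ0 _).trans (hZ0 _).symm)
      rw [hdel _ _ _ ih t ⟨ht.1, ht.2.trans (by push_cast; linarith)⟩]
  have hle : ∀ j k : ℕ, j ≤ k → EqOn (Z k).1 (Z j).1 (Icc 0 (j * δ)) := by
    intro j k hjk
    induction k, hjk using Nat.le_induction with
    | base => exact fun t _ => rfl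
    | succ k hjk ih =>
      intro t ht
      rw [← ih ht]
      exact hsucc k ⟨ht.1, ht.2.trans (by gcongr)⟩
  have hceil : ∀ t, t ≤ ⌈t / δ⌉₊ * δ := fun t => (div_le_iff₀ hδ).1 (Nat.le_ceil _)
  let x : ℝ → Vec n := fun t => (Z ⌈t / δ⌉₊).1 t
  have hxZ : ∀ T, EqOn x (Z ⌈T / δ⌉₊).1 (Icc 0 T) := fun T t ht =>
    (hle _ _ (Nat.ceil_mono (by gcongr; exact ht.2)) ⟨ht.1, hceil t⟩).symm
  have hx : ∀ T, IsTraj f (fun s => (delayed θ x₀ x s, u s)) 0 T x := by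
    intro T
    -- The next iterate solves the equation driven by the current one, and both agree with `x` on
    -- `[0, T]`.
    have h1 : EqOn x (Z (⌈T / δ⌉₊ + 1)).1 (Icc 0 T) := fun t ht => by
      rw [hxZ T ht, hsucc _ ⟨ht.1, ht.2.trans (hceil T)⟩]
    refine ((hZ ⌈T / δ⌉₊ T).congr_field (ae_of_all _ fun t ht => ?_)).congr h1
    rw [hdel _ _ T (hxZ T) t ⟨ht.1, by linarith [ht.2]⟩]
  have hx0 : x 0 = x₀ 0 := hZ0 _
  have hv := hXV x₀ hx₀ x (continuousOn_Ici_of_forall_Icc fun T => (hx T).continuousOn) hx0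
  exact ⟨x, (isODESolution_top_iff hf (memLp_input (hV hv) hu)).2 ⟨hx0, hx⟩⟩

/-- Bounded reachability sets of the delay system by the method of steps. -/
theorem ODEForwardComplete.tdsBoundedReach (hf : Continuous f)
    (hL : LipOnBalls (W := (Fin p → Vec n) × Vec m) f) (hθ : ∀ k, 0 < θ k)
    (h : ODEForwardComplete f (delayInputsLinf n p)) :
    TDSBoundedReach f θ (stateLinf n θ) (normLinf θ) := by
  have hθ0 : ∀ k, 0 ≤ θ k := fun k => (hθ k).le
  refine ⟨h.tdsForwardComplete hf hL hθ Subset.rfl fun x₀ hx₀ x hx _ =>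
    delayed_mem_delayInputsLinf hθ0 hx₀ hx, fun r hr => ?_⟩
  obtain ⟨δ, hδ, hδθ⟩ := exists_pos_forall_le hθ
  have key : ∀ j : ℕ, ∃ C : ℝ, ∀ x₀ ∈ stateLinf n θ, ∀ u ∈ inputs m, ∀ x : ℝ → Vec n,
      normLinf θ x₀ ≤ ENNReal.ofReal r → inputNorm u ≤ ENNReal.ofReal r →
      IsTDSSolution f θ ⊤ x₀ u x → ∀ t ∈ Icc 0 r, t ≤ j * δ → ‖x t‖ ≤ C := by
    intro j
    induction j with
    | zero =>
      refine ⟨r, fun x₀ _ u _ x hx₀ _ hx t ht htj => ?_⟩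
      obtain rfl : t = 0 := le_antisymm (by simpa using htj) ht.1
      have h1 := (le_max_right _ _).trans hx₀
      rw [hx.1]
      rwa [← ofReal_norm, ENNReal.ofReal_le_ofReal_iff hr.le] at h1
    | succ j ih =>
      obtain ⟨C, hC⟩ := ih
      -- Up to time `(j + 1) * δ` the delayed values come from the initial state or from `[0, j *
      -- δ]`, so `max C r` bounds the delay-inputs of this step.
      have hρ : 0 ≤ max C r := hr.le.trans (le_max_right _ _)
      obtain ⟨C', hC'⟩ := exists_bound_of_forward_complete hf hL hρ r
        fun x w hw => h.exists_isTraj hf x w hw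
      refine ⟨C', fun x₀ hx₀ u hu x hx₀r hur hx t ht htj => ?_⟩
      have hxc : ContinuousOn x (Ici 0) := by
        rw [← timeInterval_top]; exact hx.2.1
      have hw := memLp_input (delayed_mem_delayInputsLinf hθ0 hx₀ hxc) hu
      obtain ⟨hx0, hxt⟩ := (isODESolution_top_iff hf hw).1 (isTDSSolution_iff.1 hx)
      have hx₀ae : ∀ᵐ s, s ∈ Icc (-maxDelay θ) 0 → ‖x₀ s‖ ≤ r := by
        have h1 := (le_max_left _ _).trans hx₀r
        rw [eLpNorm_exponent_top] at h1
        filter_upwards [(ae_restrict_iff' measurableSet_Icc).1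
          (ae_le_eLpNormEssSup (f := x₀) (μ := volume.restrict (Icc (-maxDelay θ) 0)))] with s hs hsm
        have h2 := (hs hsm).trans h1
        rwa [← ofReal_norm, ENNReal.ofReal_le_ofReal_iff hr.le] at h2
      have hv := ae_norm_delayed_le (T := t) (x := x)
        (hx₀ae.mono fun s hs hsm => (hs hsm).trans (le_max_right C r)) hρ fun s hs k hk =>
          (hC x₀ hx₀ u hu x hx₀r hur hx (s - θ k) ⟨hk.le, by linarith [hs.2, hθ k, ht.2]⟩ (by
            push_cast at htj
            linarith [hs.2, hδθ k])).trans (le_max_left _ _)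
      have hu' := ae_norm_le_Icc_of_Ioi (ae_norm_le_of_inputNorm_le hr.le hur) t
      obtain ⟨w, hwb, hweq⟩ := exists_isBoundedInput_ae_eq hρ (hw t).1 (by
        filter_upwards [hv, hu'] with s h1 h2 h3
        exact max_le (h1 h3) ((h2 h3).trans (le_max_right _ _)))
      refine hC' w hwb x ?_ t ht ((hxt t).congr_field ?_)
      · have h1 := (le_max_right _ _).trans hx₀r
        rw [← ofReal_norm, ENNReal.ofReal_le_ofReal_iff hr.le] at h1
        rw [hx0]
        exact h1.trans (le_max_right _ _)
      · filter_upwards [hweq] with s hs hst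
        rw [hs hst]
  obtain ⟨C, hC⟩ := key ⌈r / δ⌉₊
  refine (Metric.isBounded_closedBall (x := (0 : Vec n)) (r := C)).subset ?_
  rintro ξ ⟨t, ht, x₀, hx₀, u, hu, x, hx₀r, hur, hx, rfl⟩
  rw [mem_closedBall_zero_iff]
  exact hC x₀ hx₀ u hu x hx₀r hur hx t ht (ht.2.trans ((div_le_iff₀ hδ).1 (Nat.le_ceil _)))

end MethodOfSteps

/-! ### Initial states with prescribed delayed values -/

section Interpolation

/-- A continuous bump, equal to `1` on `[0, 1]` and to `0` outside of `(-1, 2)`. -/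
noncomputable def bump (y : ℝ) : ℝ := max 0 (min 1 (min (1 + y) (2 - y)))

theorem continuous_bump : Continuous bump := by unfold bump; fun_prop

theorem bump_nonneg (y : ℝ) : 0 ≤ bump y := le_max_left _ _

theorem bump_le_one (y : ℝ) : bump y ≤ 1 := max_le zero_le_one (min_le_left _ _)

theorem bump_eq_one {y : ℝ} (h0 : 0 ≤ y) (h1 : y ≤ 1) : bump y = 1 := by
  rw [bump, min_eq_left (le_min (by linarith) (by linarith)), max_eq_right zero_le_one]

theorem bump_eq_zero_of_le {y : ℝ} (h : y ≤ -1) : bump y = 0 :=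
  max_eq_left ((min_le_right _ _).trans ((min_le_left _ _).trans (by linarith)))

theorem bump_eq_zero_of_ge {y : ℝ} (h : 2 ≤ y) : bump y = 0 :=
  max_eq_left ((min_le_right _ _).trans ((min_le_right _ _).trans (by linarith)))

variable {n m p : ℕ}

/-- An initial state with value `z₀` at `0` whose delayed values are the delay-inputs `v` during
a short time `δ`. -/
noncomputable def interpolate (θ : Fin p → ℝ) (δ : ℝ) (z₀ : Vec n) (v : ℝ → Fin p → Vec n)
    (s : ℝ) : Vec n :=
  bump (s / δ) • z₀ + ∑ k, bump ((s + θ k) / δ) • v (max (s + θ k) 0) k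

/-- The delays and their differences are at least `3 δ`. -/
def Separated (θ : Fin p → ℝ) (δ : ℝ) : Prop :=
  0 < δ ∧ ∀ k, 3 * δ ≤ θ k ∧ ∀ j, j ≠ k → 3 * δ ≤ |θ j - θ k|

theorem exists_separated {θ : Fin p → ℝ} (hθ : ∀ k, 0 < θ k) (hθi : Function.Injective θ) :
    ∃ δ, Separated θ δ := by
  have hev : ∀ c : ℝ, 0 < c → ∀ᶠ δ in 𝓝[>] (0 : ℝ), 3 * δ ≤ c := fun c hc => by
    filter_upwards [nhdsWithin_le_nhds (Iic_mem_nhds (show (0 : ℝ) < c / 3 by positivity))] with δ h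
    linarith [mem_Iic.1 h]
  have h : ∀ᶠ δ in 𝓝[>] (0 : ℝ), ∀ k, 3 * δ ≤ θ k ∧ ∀ j, j ≠ k → 3 * δ ≤ |θ j - θ k| := by
    refine eventually_all.2 fun k => (hev _ (hθ k)).and (eventually_all.2 fun j => ?_)
    by_cases hjk : j = k
    · exact Eventually.of_forall fun δ h => absurd hjk h
    · exact (hev _ (abs_pos.2 (sub_ne_zero.2 (hθi.ne hjk)))).mono fun δ h _ => h
  obtain ⟨δ, hδ, hδ0⟩ := (h.and self_mem_nhdsWithin).exists
  exact ⟨δ, hδ0, hδ⟩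

variable {θ : Fin p → ℝ} {δ : ℝ} {z₀ : Vec n} {v : ℝ → Fin p → Vec n}

theorem interpolate_zero (h : Separated θ δ) : interpolate θ δ z₀ v 0 = z₀ := by
  have hk : ∀ k, bump ((0 + θ k) / δ) = 0 := fun k => by
    refine bump_eq_zero_of_ge ((le_div_iff₀ h.1).2 ?_)
    linarith [(h.2 k).1, h.1]
  simp only [interpolate, hk, zero_smul, Finset.sum_const_zero, add_zero, zero_div,
    bump_eq_one le_rfl zero_le_one, one_smul]

/-- Each scaled bump lives on an interval of length `3 * δ`, which is at most the gap between its
centers of translation; on `-θ k + [0, δ]` only the `k`-th one is nonzero, and it equals 1. -/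
theorem interpolate_sub_delay (h : Separated θ δ) {s : ℝ} (hs : s ∈ Icc 0 δ) (k : Fin p) :
    interpolate θ δ z₀ v (s - θ k) = v s k := by
  have h0 : bump ((s - θ k) / δ) = 0 := by
    refine bump_eq_zero_of_le ((div_le_iff₀ h.1).2 ?_)
    linarith [(h.2 k).1, h.1, hs.2]
  have hj : ∀ j, j ≠ k → bump ((s - θ k + θ j) / δ) = 0 := fun j hjk => by
    rcases le_abs'.1 ((h.2 k).2 j hjk) with h1 | h1
    · refine bump_eq_zero_of_le ((div_le_iff₀ h.1).2 ?_)
      linarith [h.1, hs.2]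
    · refine bump_eq_zero_of_ge ((le_div_iff₀ h.1).2 ?_)
      linarith [h.1, hs.1]
  have hk : bump ((s - θ k + θ k) / δ) = 1 := by
    rw [sub_add_cancel]
    exact bump_eq_one (div_nonneg hs.1 h.1.le) ((div_le_one h.1).2 hs.2)
  rw [interpolate, h0, zero_smul, zero_add, Finset.sum_eq_single k
    (fun j _ hjk => by rw [hj j hjk, zero_smul]) (fun h => absurd (Finset.mem_univ k) h), hk,
    one_smul, sub_add_cancel, max_eq_left hs.1]

theorem norm_interpolate_le {C : ℝ} (hz₀ : ‖z₀‖ ≤ C) (hv : ∀ s, 0 ≤ s → ‖v s‖ ≤ C) (s : ℝ) :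
    ‖interpolate θ δ z₀ v s‖ ≤ (p + 1) * C := by
  have hsmul : ∀ (y : ℝ) (a : Vec n), ‖a‖ ≤ C → ‖bump y • a‖ ≤ C := fun y a ha => by
    rw [norm_smul, Real.norm_of_nonneg (bump_nonneg y)]
    exact (mul_le_of_le_one_left (norm_nonneg _) (bump_le_one y)).trans ha
  refine (norm_add_le _ _).trans ?_
  have h1 := hsmul (s / δ) z₀ hz₀
  have h2 := norm_sum_le_of_le (f := fun k => bump ((s + θ k) / δ) • v (max (s + θ k) 0) k)
    Finset.univ (n := fun _ => C) fun k _ =>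
      hsmul _ _ ((norm_le_pi_norm _ k).trans (hv _ (le_max_right _ _)))
  rw [Finset.sum_const, Finset.card_univ, Fintype.card_fin, nsmul_eq_mul] at h2
  linarith

/-- The `max` in `interpolate` evaluates `v` only on `[0, ∞)`, where its continuity is known,
although the bumps start before time zero. -/
theorem continuous_interpolate (hv : v ∈ delayInputsC0 n p) :
    Continuous (interpolate θ δ z₀ v) := by
  have hk : ∀ k, Continuous fun s => v (max (s + θ k) 0) k := fun k =>
    (continuousOn_pi.1 hv k).comp_continuous (by fun_prop) fun s => mem_Ici.2 (le_max_right _ _)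
  refine ((continuous_bump.comp (by fun_prop)).smul continuous_const).add
    (continuous_finsetSum _ fun k _ => (continuous_bump.comp (by fun_prop)).smul (hk k))

theorem stronglyMeasurable_interpolate (hv : StronglyMeasurable v) :
    StronglyMeasurable (interpolate θ δ z₀ v) := by
  have hk : ∀ k, StronglyMeasurable fun s => v (max (s + θ k) 0) k := fun k =>
    (continuous_apply k).comp_stronglyMeasurable
      (hv.comp_measurable ((measurable_id.add_const _).max measurable_const))
  have hb : ∀ c : ℝ, StronglyMeasurable fun s => bump ((s + c) / δ) := fun c =>
    (continuous_bump.comp (by fun_prop)).stronglyMeasurable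
  unfold interpolate
  refine StronglyMeasurable.add (StronglyMeasurable.smul_const (by simpa using hb 0) z₀) ?_
  exact Finset.stronglyMeasurable_fun_sum _ fun k _ => (hb (θ k)).smul (hk k)

end Interpolation

/-! ### From the delay system back to the equation -/

section DelayToODE

variable {n m p : ℕ} {f : Field n m p} {θ : Fin p → ℝ} {δ : ℝ}

theorem isTraj_of_interpolate (hf : Continuous f) (hsep : Separated θ δ) {z₀ : Vec n}
    {v : ℝ → Fin p → Vec n} {u : ℝ → Vec m} {x : ℝ → Vec n} (hu : u ∈ inputs m)
    (hx₀ : interpolate θ δ z₀ v ∈ stateLinf n θ)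
    (hx : IsTDSSolution f θ ⊤ (interpolate θ δ z₀ v) u x) :
    x 0 = z₀ ∧ IsTraj f (fun s => (v s, u s)) 0 δ x := by
  have hθ : ∀ k, 0 ≤ θ k := fun k => by linarith [hsep.1, (hsep.2 k).1]
  have hxc : ContinuousOn x (Ici 0) := by
    rw [← timeInterval_top]; exact hx.2.1
  obtain ⟨hx0, hxt⟩ := (isODESolution_top_iff hf
    (memLp_input (delayed_mem_delayInputsLinf hθ hx₀ hxc) hu)).1 (isTDSSolution_iff.1 hx)
  refine ⟨hx0.trans (interpolate_zero hsep), (hxt δ).congr_field (ae_of_all _ fun s hs => ?_)⟩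
  congr 3
  funext k
  rw [delayed, concat_of_nonpos (by linarith [hs.2, (hsep.2 k).1, hsep.1]),
    interpolate_sub_delay hsep hs]

theorem inputs_shift {u : ℝ → Vec m} (hu : u ∈ inputs m) {t₀ : ℝ} (ht₀ : 0 ≤ t₀) :
    (fun s => u (s + t₀)) ∈ inputs m := by
  refine mem_inputs_of_memLp_Icc fun T => ?_
  have h1 := (measurePreserving_add_right volume t₀).restrict_preimage
    (s := Icc t₀ (T + t₀)) measurableSet_Icc
  rw [preimage_add_const_Icc, sub_self, add_sub_cancel_right] at h1
  exact ((memLp_Icc_of_mem_inputs hu (T + t₀)).mono_measure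
    (Measure.restrict_mono_set _ (Icc_subset_Icc_left ht₀))).comp_measurePreserving h1

/-- At each `t₀` the delay system is restarted from the interpolation of the current point and the
shifted `v`. Its solution obeys the equation for a time `δ`, independent of the restart, and the
pieces glue. -/
theorem TDSForwardComplete.exists_isTraj (hf : Continuous f) (hsep : Separated θ δ)
    {X : Set (ℝ → Vec n)} (hX : X ⊆ stateLinf n θ) (h : TDSForwardComplete f θ X)
    {v : ℝ → Fin p → Vec n} {u : ℝ → Vec m} (hu : u ∈ inputs m)
    (hv : ∀ t₀, 0 ≤ t₀ → ∀ z₀, interpolate θ δ z₀ (fun s => v (s + t₀)) ∈ X) (T : ℝ) (x : Vec n) :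
    ∃ z : ℝ → Vec n, z 0 = x ∧ IsTraj f (fun s => (v s, u s)) 0 T z := by
  refine exists_isTraj_of_step hsep.1 (fun t₀ ht₀ y => ?_) x
  have hu' := inputs_shift hu ht₀.1
  obtain ⟨z, hz⟩ := h _ (hv t₀ ht₀.1 y) _ hu'
  obtain ⟨hz0, hzt⟩ := isTraj_of_interpolate hf hsep hu' (hX (hv t₀ ht₀.1 y)) hz
  refine ⟨fun s => z (s + -t₀), by simpa using hz0, ?_⟩
  have h2 : IsTraj f (fun s => (v (s + t₀), u (s + t₀))) (t₀ + -t₀) (t₀ + δ + -t₀) z := by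
    convert hzt using 1 <;> ring
  simpa using h2.shift

theorem TDSForwardComplete.odeForwardComplete_c0 (hf : Continuous f)
    (hL : LipOnBalls (W := (Fin p → Vec n) × Vec m) f) (hsep : Separated θ δ)
    (h : TDSForwardComplete f θ (stateC0 n θ)) : ODEForwardComplete f (delayInputsC0 n p) := by
  refine odeForwardComplete_of_forall_isTraj hf hL delayInputsC0_subset_delayInputsLinf
    fun x v hv u hu T _ => h.exists_isTraj hf hsep stateC0_subset_stateLinf hu
      (fun t₀ ht₀ z₀ => ?_) T x
  refine (continuous_interpolate ?_).continuousOn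
  exact ContinuousOn.comp hv (by fun_prop) fun s hs => mem_Ici.2 (add_nonneg hs ht₀)

theorem TDSForwardComplete.odeForwardComplete_linf (hf : Continuous f)
    (hL : LipOnBalls (W := (Fin p → Vec n) × Vec m) f) (hsep : Separated θ δ)
    (h : TDSForwardComplete f θ (stateLinf n θ)) : ODEForwardComplete f (delayInputsLinf n p) := by
  refine odeForwardComplete_of_forall_isTraj hf hL Subset.rfl fun x v hv u hu T _ => ?_
  have hw := memLp_input hv hu T
  obtain ⟨r, hr0, hr⟩ := hw.exists_ae_norm_le_on measurableSet_Icc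
  -- The interpolated state involves `v` at all positive times, so a representative bounded and
  -- measurable everywhere is needed.
  obtain ⟨w, hwb, hweq⟩ := exists_isBoundedInput_ae_eq hr0 hw.1 hr
  obtain ⟨z, hz0, hz⟩ := h.exists_isTraj hf hsep Subset.rfl hwb.snd_mem (v := fun s => (w s).1)
    (fun t₀ _ z₀ => memLp_top_of_bound (stronglyMeasurable_interpolate
      (hwb.shift t₀).1.fst).aestronglyMeasurable ((p + 1) * max ‖z₀‖ r)
      (ae_of_all _ (norm_interpolate_le (le_max_left _ _) fun s _ =>
        ((norm_fst_le _).trans (hwb.2 _)).trans (le_max_right _ _)))) T x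
  refine ⟨z, hz0, hz.congr_field ?_⟩
  filter_upwards [hweq] with s hs hst
  rw [hs hst]

/-- Continuous functions equal almost everywhere are equal; applied to `max ‖v‖ r` and `r`, this
upgrades an essential bound to a pointwise one, as `normC0` demands. -/
theorem norm_le_of_inputNorm_le_of_continuousOn {V : Type*} [NormedAddCommGroup V] {v : ℝ → V}
    {r : ℝ} (hr : 0 ≤ r) (hv : ContinuousOn v (Ici 0)) (h : inputNorm v ≤ ENNReal.ofReal r) :
    ∀ s, 0 ≤ s → ‖v s‖ ≤ r := by
  have h1 : EqOn (fun s => max ‖v s‖ r) (fun _ => r) (Ici 0) := by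
    refine Measure.eqOn_of_ae_eq (μ := volume) ?_ (hv.norm.sup continuousOn_const)
      continuousOn_const (by rw [interior_Ici, closure_Ioi])
    rw [EventuallyEq, ae_restrict_iff' measurableSet_Ici]
    filter_upwards [ae_norm_le_of_inputNorm_le hr h, Measure.ae_ne volume 0] with s hs hs0 hsm
    exact max_eq_right (hs (lt_of_le_of_ne hsm (Ne.symm hs0)))
  exact fun s hs => max_eq_right_iff.1 (h1 hs)

theorem TDSBoundedReach.odeBoundedReach_c0 (hf : Continuous f)
    (hL : LipOnBalls (W := (Fin p → Vec n) × Vec m) f) (hsep : Separated θ δ)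
    (h : TDSBoundedReach f θ (stateC0 n θ) (normC0 θ)) :
    ODEBoundedReach f (delayInputsC0 n p) := by
  refine ⟨h.1.odeForwardComplete_c0 hf hL hsep, fun r hr => ?_⟩
  have hδ := hsep.1
  have key : ∀ j : ℕ, ∃ C : ℝ, ∀ v ∈ delayInputsC0 n p, ∀ u ∈ inputs m, ∀ z : ℝ → Vec n,
      inputNorm v ≤ ENNReal.ofReal r → inputNorm u ≤ ENNReal.ofReal r → ‖z 0‖ ≤ r →
      (∀ T, IsTraj f (fun s => (v s, u s)) 0 T z) → ∀ t ∈ Icc 0 r, t ≤ j * δ → ‖z t‖ ≤ C := by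
    intro j
    induction j with
    | zero =>
      refine ⟨r, fun v _ u _ z _ _ hz0 _ t ht htj => ?_⟩
      obtain rfl : t = 0 := le_antisymm (by simpa using htj) ht.1
      exact hz0
    | succ j ih =>
      obtain ⟨C, hC⟩ := ih
      -- The interpolated state is a sum of `p + 1` terms bounded by `max C r`; `ρ` must also
      -- dominate the duration `δ` and the input bound `r`.
      set ρ := max ((p + 1) * max C r) (max δ r)
      have hrρ : r ≤ ρ := (le_max_right _ _).trans (le_max_right _ _)
      have hδρ : δ ≤ ρ := (le_max_left _ _).trans (le_max_right _ _)
      have hρ : 0 < ρ := hr.trans_le hrρ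
      obtain ⟨C', hC'⟩ := (h.2 ρ hρ).exists_norm_le
      refine ⟨max C C', fun v hv u hu z hvr hur hz0 hz t ht htj => ?_⟩
      set t₀ : ℝ := j * δ
      have ht₀ : 0 ≤ t₀ := by positivity
      rcases le_total t t₀ with htt | htt
      · exact (hC v hv u hu z hvr hur hz0 hz t ht htt).trans (le_max_left _ _)
      have hzt₀ := hC v hv u hu z hvr hur hz0 hz t₀ ⟨ht₀, htt.trans ht.2⟩ le_rfl
      have hvn := norm_le_of_inputNorm_le_of_continuousOn hr.le hv hvr
      have hv' : (fun s => v (s + t₀)) ∈ delayInputsC0 n p :=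
        ContinuousOn.comp hv (by fun_prop) fun s hs => mem_Ici.2 (add_nonneg hs ht₀)
      have hx₀ : interpolate θ δ (z t₀) (fun s => v (s + t₀)) ∈ stateC0 n θ :=
        (continuous_interpolate hv').continuousOn
      have hu' := inputs_shift hu ht₀
      have hx₀ρ : normC0 θ (interpolate θ δ (z t₀) fun s => v (s + t₀)) ≤ ENNReal.ofReal ρ := by
        refine iSup₂_le fun s _ => ?_
        rw [← ofReal_norm]
        refine ENNReal.ofReal_le_ofReal ((norm_interpolate_le (C := max C r)
          (hzt₀.trans (le_max_left _ _)) (fun s hs => ?_) s).trans (le_max_left _ _))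
        exact (hvn _ (add_nonneg hs ht₀)).trans (le_max_right _ _)
      have hu'ρ : inputNorm (fun s => u (s + t₀)) ≤ ENNReal.ofReal ρ := by
        refine inputNorm_le_of_ae_norm_le ?_
        filter_upwards [(measurePreserving_add_right volume t₀).quasiMeasurePreserving.ae
          (ae_norm_le_of_inputNorm_le hr.le hur)] with s hs hs0
        exact (hs (by linarith)).trans hrρ
      obtain ⟨x, hx⟩ := h.1 _ hx₀ _ hu'
      obtain ⟨hx0, hxt⟩ := isTraj_of_interpolate hf hsep hu' (stateC0_subset_stateLinf hx₀) hx
      have hzs : IsTraj f (fun s => (v (s + t₀), u (s + t₀))) 0 δ (fun s => z (s + t₀)) :=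
        IsTraj.shift (w := fun s => (v s, u s)) ((hz (δ + t₀)).mono (by simpa using ht₀) le_rfl)
      have htδ : t - t₀ ∈ Icc 0 δ := ⟨sub_nonneg.2 htt, by
        push_cast at htj
        linarith⟩
      have heq := hzs.eqOn hL (memLp_input (delayInputsC0_subset_delayInputsLinf hv') hu' δ) hxt
        (by simpa using hx0.symm) htδ
      simp only [sub_add_cancel] at heq
      rw [heq]
      exact (hC' _ ⟨t - t₀, ⟨htδ.1, htδ.2.trans hδρ⟩, _, hx₀, _, hu', x, hx₀ρ, hu'ρ, hx,
        rfl⟩).trans (le_max_right _ _)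
  obtain ⟨C, hC⟩ := key ⌈r / δ⌉₊
  refine (Metric.isBounded_closedBall (x := (0 : Vec n)) (r := C)).subset ?_
  rintro ξ ⟨t, ht, z₀, v, hv, u, hu, z, hz₀, hvr, hur, hz, rfl⟩
  obtain ⟨hz0, hzt⟩ := (isODESolution_top_iff hf
    (memLp_input (delayInputsC0_subset_delayInputsLinf hv) hu)).1 hz
  rw [mem_closedBall_zero_iff]
  exact hC v hv u hu z hvr hur (by rwa [hz0]) hzt t ht
    (ht.2.trans ((div_le_iff₀ hδ).1 (Nat.le_ceil _)))

end DelayToODE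

/-! ### The two groups of equivalent statements -/

section Equivalences

variable {n m p : ℕ} {f : Field n m p} {θ : Fin p → ℝ}

theorem tfae_forwardComplete_boundedReach (hf : Continuous f)
    (hL : LipOnBalls (W := (Fin p → Vec n) × Vec m) f) (hθ : ∀ k, 0 < θ k)
    (hθi : Function.Injective θ) :
    [TDSForwardComplete f θ (stateLinf n θ),
      TDSBoundedReach f θ (stateLinf n θ) (normLinf θ),
      TDSBoundedReach f θ (stateC0 n θ) (normC0 θ),
      ODEForwardComplete f (delayInputsLinf n p),
      ODEBoundedReach f (delayInputsLinf n p),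
      ODEBoundedReach f (delayInputsC0 n p)].TFAE := by
  obtain ⟨δ, hsep⟩ := exists_separated hθ hθi
  tfae_have 1 → 4 := fun h => h.odeForwardComplete_linf hf hL hsep
  tfae_have 4 → 5 := fun h => h.boundedReach hf hL
  tfae_have 5 → 2 := fun h => h.1.tdsBoundedReach hf hL hθ
  tfae_have 2 → 1 := fun h => h.1
  tfae_have 2 → 3 := fun h => h.c0_of_linf fun k => (hθ k).le
  tfae_have 3 → 6 := fun h => h.odeBoundedReach_c0 hf hL hsep
  tfae_have 6 → 5 := fun h => h.linf_of_c0 hf hL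
  tfae_finish

theorem tdsForwardComplete_c0_iff (hf : Continuous f)
    (hL : LipOnBalls (W := (Fin p → Vec n) × Vec m) f) (hθ : ∀ k, 0 < θ k)
    (hθi : Function.Injective θ) :
    TDSForwardComplete f θ (stateC0 n θ) ↔ ODEForwardComplete f (delayInputsC0 n p) := by
  obtain ⟨δ, hsep⟩ := exists_separated hθ hθi
  exact ⟨fun h => h.odeForwardComplete_c0 hf hL hsep,
    fun h => h.tdsForwardComplete hf hL hθ delayInputsC0_subset_delayInputsLinf
      fun x₀ hx₀ x hx h0 => delayed_mem_delayInputsC0 hx₀ hx h0⟩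

end Equivalences

/-! ### A field that explodes only under discontinuous delay-inputs -/

section Counterexample

theorem lipOnBalls_of_locallyLipschitz {E W : Type*} [NormedAddCommGroup E] [NormedSpace ℝ E]
    [NormedAddCommGroup W] [ProperSpace E] [ProperSpace W] {g : E × W → E}
    (hg : LocallyLipschitz g) : LipOnBalls g := by
  intro R
  obtain ⟨L, hL⟩ := (hg.locallyLipschitzOn
    (s := Metric.closedBall 0 R)).exists_lipschitzOnWith_of_compact (isCompact_closedBall _ _)
  refine ⟨L, fun w hw => LipschitzOnWith.of_dist_le_mul fun x hx y hy => ?_⟩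
  have hmem : ∀ x ∈ Metric.closedBall (0 : E) R, (x, w) ∈ Metric.closedBall (0 : E × W) R :=
    fun x hx => by
      rw [mem_closedBall_zero_iff] at hx ⊢
      exact max_le hx hw
  have h1 := hL.dist_le_mul (x, w) (hmem x hx) (y, w) (hmem y hy)
  rwa [Prod.dist_eq (x := (x, w)), dist_self, max_eq_left dist_nonneg] at h1

/-- A tent function, positive exactly on `(-1/2, 1/2)`. -/
noncomputable def tent (y : ℝ) : ℝ := max 0 (1 - 2 * |y|)

theorem tent_zero : tent 0 = 1 := by simp [tent]

theorem tent_nonneg (y : ℝ) : 0 ≤ tent y := le_max_left _ _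

theorem tent_eq_zero {y : ℝ} (h : 1 / 2 ≤ |y|) : tent y = 0 := max_eq_left (by linarith)

theorem lipschitzWith_tent : LipschitzWith 2 tent := by
  refine LipschitzWith.of_dist_le_mul fun x y => ?_
  rw [Real.dist_eq, Real.dist_eq, tent, tent]
  refine (abs_max_sub_max_le_max _ _ _ _).trans (max_le (by simp) ?_)
  rw [show (1 - 2 * |x|) - (1 - 2 * |y|) = 2 * (|y| - |x|) by ring, abs_mul, abs_two,
    abs_sub_comm x y]
  exact mul_le_mul_of_nonneg_left (abs_abs_sub_abs_le _ _) zero_le_two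

/-- A scalar field whose solutions explode only for inputs that follow the cosine of the state. -/
noncomputable def resonantScalar (q : ℝ × ℝ) : ℝ := q.1 ^ 2 * tent (q.2 - Real.cos q.1)

theorem locallyLipschitz_resonantScalar : LocallyLipschitz resonantScalar := by
  have h1 : LocallyLipschitz fun q : ℝ × ℝ => q.1 ^ 2 :=
    (ContDiff.locallyLipschitz (𝕂 := ℝ) (by fun_prop))
  have h2 : LocallyLipschitz fun q : ℝ × ℝ => tent (q.2 - Real.cos q.1) :=
    lipschitzWith_tent.locallyLipschitz.comp
      (f := tent) (g := fun q : ℝ × ℝ => q.2 - Real.cos q.1)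
      (ContDiff.locallyLipschitz (𝕂 := ℝ) (by fun_prop))
  have h3 : LocallyLipschitz fun q : ℝ × ℝ => q.1 * q.2 :=
    (ContDiff.locallyLipschitz (𝕂 := ℝ) (by fun_prop))
  exact h3.comp (h1.prodMk h2)

theorem resonantScalar_nonneg (q : ℝ × ℝ) : 0 ≤ resonantScalar q :=
  mul_nonneg (sq_nonneg _) (tent_nonneg _)

/-- Multiples of `π` are barriers for the scalar field. -/
theorem exists_barrier (c y : ℝ) :
    ∃ b : ℝ, 0 < b ∧ |y| ≤ b ∧ ∀ c', |c' - c| ≤ 1 / 2 → resonantScalar (b, c') = 0 := by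
  obtain ⟨N, hN⟩ := exists_nat_gt |y|
  have hpi := Real.pi_gt_three
  have hN0 : (0 : ℝ) ≤ N := Nat.cast_nonneg N
  -- Inputs within `1 / 2` of `c ≤ 0` are at least `1 / 2` away from `1`, so points with cosine `1`
  -- are zeros of the field; for `c ≥ 0` points with cosine `-1` serve.
  rcases le_total c 0 with hc | hc
  · refine ⟨(N + 1 : ℕ) * (2 * Real.pi), by positivity, ?_, fun c' hc' => ?_⟩
    · push_cast
      nlinarith
    · rw [resonantScalar, Real.cos_nat_mul_two_pi, tent_eq_zero, mul_zero]
      rw [abs_of_neg] <;> linarith [(abs_le.1 hc').2]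
  · refine ⟨(N : ℕ) * (2 * Real.pi) + Real.pi, by positivity, ?_, fun c' hc' => ?_⟩
    · nlinarith
    · rw [resonantScalar, Real.cos_nat_mul_two_pi_add_pi, tent_eq_zero, mul_zero]
      rw [abs_of_pos] <;> linarith [(abs_le.1 hc').1]

/-- Solutions of the scalar equation exist as long as the input varies little. -/
theorem exists_isTraj_resonantScalar {w : ℝ → ℝ} {a b : ℝ} (hw : ContinuousOn w (Icc a b))
    (hvar : ∀ t ∈ Icc a b, |w t - w a| ≤ 1 / 2) (y : ℝ) :
    ∃ z : ℝ → ℝ, z a = y ∧ IsTraj resonantScalar w a b z := by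
  obtain ⟨B, hB, hyB, hzero⟩ := exists_barrier (w a) y
  have hcont : Continuous resonantScalar := locallyLipschitz_resonantScalar.continuous
  obtain ⟨r, hr⟩ := isCompact_Icc.exists_bound_of_continuousOn hw
  -- Truncating at the barrier `B` makes the field vanish at all states above `B`. The nondecreasing
  -- solution therefore cannot exceed `B`, and the truncation is inactive.
  obtain ⟨K, hK⟩ := (lipOnBalls_of_locallyLipschitz locallyLipschitz_resonantScalar).cutoff hB r
  obtain ⟨z, hza, hz⟩ := exists_isTraj_of_lipschitz (continuous_cutoff hB hcont) hK
    (memLp_top_of_ae_norm_le measurableSet_Icc (hw.aestronglyMeasurable measurableSet_Icc)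
      (ae_of_all _ hr)) (ae_of_all _ hr) y
  have hmono : ∀ s ∈ Icc a b, ∀ t ∈ Icc s b, z s ≤ z t := fun s hs t ht => by
    rw [(hz.mono hs.1 le_rfl).eq_add_integral t ht]
    exact le_add_of_nonneg_right
      (intervalIntegral.integral_nonneg ht.1 fun q _ => resonantScalar_nonneg _)
  have hle : ∀ t ∈ Icc a b, z t ≤ B := by
    intro t ht
    by_contra! hlt
    obtain ⟨s, hs, hsB⟩ := intermediate_value_Icc ht.1
      (hz.continuousOn.mono (Icc_subset_Icc_right ht.2))
      ⟨by rw [hza]; exact (le_abs_self y).trans hyB, hlt.le⟩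
    have hs' : s ∈ Icc a b := ⟨hs.1, hs.2.trans ht.2⟩
    have h1 := (hz.mono hs.1 le_rfl).eq_add_integral t ⟨hs.2, ht.2⟩
    have h2 : ∫ q in s..t, cutoff resonantScalar B (z q, w q) = 0 := by
      refine intervalIntegral.integral_zero_ae (ae_of_all _ fun q hq => ?_)
      rw [uIoc_of_le hs.2] at hq
      have hBq : B ≤ z q := by
        rw [← hsB]
        exact hmono s hs' q ⟨hq.1.le, hq.2.trans ht.2⟩
      have hq0 : 0 < z q := hB.trans_le hBq
      have h3 : radialRetraction B (z q) = B := by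
        rw [radialRetraction, Real.norm_of_nonneg hq0.le, max_eq_right hBq, smul_eq_mul,
          div_mul_cancel₀ _ hq0.ne']
      rw [cutoff, h3]
      exact hzero _ (hvar q ⟨hs.1.trans hq.1.le, hq.2.trans ht.2⟩)
    rw [h1, h2, add_zero, hsB] at hlt
    exact lt_irrefl _ hlt
  refine ⟨z, hza, hz.of_cutoff hB fun t ht => abs_le.2 ⟨?_, hle t ht⟩⟩
  have h1 := hmono a ⟨le_rfl, ht.1.trans ht.2⟩ t ht
  rw [hza] at h1
  linarith [neg_abs_le y]

variable {n m p : ℕ}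

/-- The scalar field acting on one coordinate of the state and of one of the delay-inputs. -/
noncomputable def resonantField (m : ℕ) (i : Fin n) (k : Fin p) : Field n m p := fun q =>
  resonantScalar (q.1 i, q.2.1 k i) • EuclideanSpace.single i (1 : ℝ)

variable {i : Fin n} {k : Fin p}

theorem locallyLipschitz_resonantField :
    LocallyLipschitz fun q : Vec n × (Fin p → Vec n) =>
      resonantScalar (q.1 i, q.2 k i) • EuclideanSpace.single i (1 : ℝ) := by
  have h1 : LocallyLipschitz fun q : Vec n × (Fin p → Vec n) => (q.1 i, q.2 k i) :=
    (ContDiff.locallyLipschitz (𝕂 := ℝ) (by fun_prop))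
  have h2 : LocallyLipschitz fun a : ℝ => a • EuclideanSpace.single i (1 : ℝ) :=
    (ContDiff.locallyLipschitz (𝕂 := ℝ) (by fun_prop))
  exact h2.comp (locallyLipschitz_resonantScalar.comp h1)

theorem continuous_resonantField : Continuous (resonantField m i k) :=
  (locallyLipschitz_resonantField (i := i) (k := k)).continuous.comp
    (f := fun q : Vec n × (Fin p → Vec n) × Vec m => (q.1, q.2.1)) (by fun_prop)

theorem locLipschitzUniformlyOn_resonantField :
    LocLipschitzUniformlyOn (resonantField m i k) univ := by
  intro q
  obtain ⟨L, N, hN, hL⟩ := locallyLipschitz_resonantField (i := i) (k := k) q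
  exact ⟨N, hN, L, fun u _ => hL⟩

theorem LocLipschitzUniformlyOn.mono {f : Field n m p} {K K' : Set (Vec m)}
    (h : LocLipschitzUniformlyOn f K') (hK : K ⊆ K') : LocLipschitzUniformlyOn f K := by
  intro q
  obtain ⟨N, hN, L, hL⟩ := h q
  exact ⟨N, hN, L, fun u hu => hL u (hK hu)⟩

theorem lipOnBalls_resonantField :
    LipOnBalls (W := (Fin p → Vec n) × Vec m) (resonantField m i k) :=
  LocLipschitzUniformlyOn.lipOnBalls continuous_resonantField fun K _ =>
    locLipschitzUniformlyOn_resonantField.mono (subset_univ K)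

/-- The field is parallel to the `i`-th basis vector and sees only the `i`-th coordinate, so the
other coordinates stay frozen. -/
theorem isTraj_resonantField {v : ℝ → Fin p → Vec n} {u : ℝ → Vec m} {a b : ℝ} {y : ℝ → ℝ}
    (h : IsTraj resonantScalar (fun s => v s k i) a b y) {x : Vec n} (hx : y a = x i) :
    IsTraj (resonantField m i k) (fun s => (v s, u s)) a b
      (fun t => x + (y t - y a) • EuclideanSpace.single i (1 : ℝ)) := by
  have hcoord : ∀ t, (x + (y t - y a) • EuclideanSpace.single i (1 : ℝ) : Vec n) i = y t :=
    fun t => by simp [hx]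
  have hfield : ∀ t, resonantField m i k
      (x + (y t - y a) • EuclideanSpace.single i (1 : ℝ), v t, u t)
      = resonantScalar (y t, v t k i) • EuclideanSpace.single i (1 : ℝ) := fun t => by
    rw [resonantField]
    simp only [hcoord]
  refine ⟨continuousOn_const.add ((h.continuousOn.sub continuousOn_const).smul continuousOn_const),
    ?_, fun t ht => ?_⟩
  · simp only [hfield]
    exact h.integrableOn.smul_const _
  · simp only [hfield, sub_self, zero_smul, add_zero]
    rw [intervalIntegral.integral_smul_const, h.eq_add_integral t ht, add_sub_cancel_left]

theorem odeForwardComplete_c0_resonantField :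
    ODEForwardComplete (resonantField m i k) (delayInputsC0 n p) := by
  refine odeForwardComplete_of_forall_isTraj continuous_resonantField lipOnBalls_resonantField
    delayInputsC0_subset_delayInputsLinf fun x v hv u _ T _ => ?_
  have hvc : ContinuousOn (fun s => v s k i) (Ici 0) := by
    have h1 := continuousOn_pi.1 hv k
    have h2 : Continuous fun x : Vec n => x i := by fun_prop
    exact h2.comp_continuousOn h1
  -- Uniform continuity gives one step length on which `v` varies by at most `1 / 2`. The last step
  -- may pass `T` by at most 1, hence the interval `[0, T + 1]`.
  obtain ⟨δ, hδ, hδv⟩ := Metric.uniformContinuousOn_iff_le.1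
    (isCompact_Icc.uniformContinuousOn_of_continuous
      (hvc.mono (Icc_subset_Ici_self : Icc 0 (T + 1) ⊆ Ici 0))) (1 / 2) (by norm_num)
  refine exists_isTraj_of_step (δ := min δ 1) (lt_min hδ one_pos) (fun t₀ ht₀ y => ?_) x
  have hsub : Icc t₀ (t₀ + min δ 1) ⊆ Icc 0 (T + 1) :=
    Icc_subset_Icc ht₀.1 (by linarith [ht₀.2, min_le_right δ 1])
  obtain ⟨z, hz0, hz⟩ := exists_isTraj_resonantScalar (a := t₀) (b := t₀ + min δ 1)
    (hvc.mono (hsub.trans Icc_subset_Ici_self)) (fun t ht => by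
      have h1 : dist t t₀ ≤ δ := by
        rw [Real.dist_eq, abs_of_nonneg (sub_nonneg.2 ht.1)]
        linarith [ht.2, min_le_left δ 1]
      exact hδv t (hsub ht) t₀ (hsub ⟨le_rfl, ht.1.trans ht.2⟩) h1) (y i)
  exact ⟨_, by simp, isTraj_resonantField hz hz0⟩

/-- The input `cos (1 / (1 - t))` makes the solution `1 / (1 - t)` explode at time `1`. -/
theorem isTraj_resonantScalar_explosion {T : ℝ} (hT : T < 1) {w : ℝ → ℝ}
    (hw : ∀ t < 1, w t = Real.cos (1 - t)⁻¹) :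
    IsTraj resonantScalar w 0 T (fun t => (1 - t)⁻¹) := by
  have hne : ∀ t ∈ Icc 0 T, 1 - t ≠ 0 := fun t ht => by linarith [ht.2]
  have hc : ContinuousOn (fun t : ℝ => (1 - t)⁻¹) (Icc 0 T) :=
    (by fun_prop : Continuous fun t : ℝ => 1 - t).continuousOn.inv₀ hne
  have hfield : ∀ t ∈ Icc 0 T, resonantScalar ((1 - t)⁻¹, w t) = ((1 - t)⁻¹) ^ 2 := fun t ht => by
    rw [resonantScalar, hw t (ht.2.trans_lt hT), sub_self, tent_zero, mul_one]
  refine ⟨hc, ((hc.pow 2).congr hfield).integrableOn_Icc, fun t ht => ?_⟩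
  have hsub : uIcc 0 t ⊆ Icc 0 T := by
    rw [uIcc_of_le ht.1]; exact Icc_subset_Icc_right ht.2
  rw [intervalIntegral.integral_eq_sub_of_hasDerivAt (f := fun t => (1 - t)⁻¹) (fun s hs => ?_)
    (((hc.pow 2).congr hfield).mono hsub).intervalIntegrable]
  · ring
  · rw [hfield s (hsub hs)]
    have h1 : HasDerivAt (fun t : ℝ => (1 - t)⁻¹) (- -1 / (1 - s) ^ 2) s :=
      ((hasDerivAt_id s).const_sub 1).inv (hne s (hsub hs))
    rwa [neg_neg, one_div, ← inv_pow] at h1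

/-- By uniqueness a global solution would follow `1 / (1 - t)` up to time 1, contradicting its
boundedness on `[0, 1]`. -/
theorem not_odeForwardComplete_linf_resonantField :
    ¬ ODEForwardComplete (resonantField m i k) (delayInputsLinf n p) := by
  intro h
  let v : ℝ → Fin p → Vec n := fun t _ =>
    (if t < 1 then Real.cos (1 - t)⁻¹ else 0) • EuclideanSpace.single i (1 : ℝ)
  have hv : v ∈ delayInputsLinf n p := fun T => by
    have h1 : Measurable fun t : ℝ => if t < 1 then Real.cos (1 - t)⁻¹ else 0 :=
      Measurable.ite measurableSet_Iio (by fun_prop) measurable_const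
    have h2 : Continuous fun a : ℝ => (fun _ : Fin p => (a • EuclideanSpace.single i (1 : ℝ) : Vec n)) :=
      continuous_pi fun _ => by fun_prop
    refine memLp_top_of_bound (h2.measurable.comp h1).aestronglyMeasurable 1
      (ae_of_all _ fun t => ?_)
    refine (pi_norm_le_iff_of_nonneg zero_le_one).2 fun _ => ?_
    simp only [v, norm_smul, PiLp.norm_single, norm_one, mul_one, Real.norm_eq_abs]
    split_ifs
    exacts [Real.abs_cos_le_one _, by simp]
  have hu : (fun _ => 0 : ℝ → Vec m) ∈ inputs m := fun T =>
    memLp_top_of_bound aestronglyMeasurable_const 0 (by simp)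
  have hw := memLp_input hv hu
  obtain ⟨z, hz⟩ := h (EuclideanSpace.single i 1) v hv _ hu
  obtain ⟨hz0, hz⟩ := (isODESolution_top_iff continuous_resonantField hw).1 hz
  obtain ⟨R, hR⟩ := isCompact_Icc.exists_bound_of_continuousOn (hz 1).continuousOn
  have hR0 : 0 ≤ R := (norm_nonneg _).trans (hR 0 ⟨le_rfl, zero_le_one⟩)
  -- At this time `1 / (1 - T) = R + 1` exceeds the bound `R`.
  set T : ℝ := 1 - (R + 1)⁻¹
  have hinv : (R + 1)⁻¹ ≤ 1 := inv_le_one_of_one_le₀ (by linarith)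
  have hinv0 : 0 < (R + 1)⁻¹ := by positivity
  have hT : T ∈ Icc 0 T := ⟨sub_nonneg.2 hinv, le_rfl⟩
  have hT1 : T < 1 := by simp only [T]; linarith
  have hexp := isTraj_resonantScalar_explosion hT1 (w := fun s => v s k i) fun t ht => by
    simp [v, ht]
  have hexp' := isTraj_resonantField (m := m) (u := fun _ => 0) hexp
    (x := EuclideanSpace.single i (1 : ℝ)) (by simp)
  have heq := (hz T).eqOn lipOnBalls_resonantField (hw T) hexp' (by simp [hz0]) hT
  have hnorm := hR T ⟨hT.1, hT1.le⟩
  have hval : z T = (R + 1) • EuclideanSpace.single i (1 : ℝ) := by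
    rw [heq]
    simp only [T, sub_sub_cancel, inv_inv, sub_zero, inv_one, sub_smul, one_smul]
    abel
  rw [hval, norm_smul, PiLp.norm_single, norm_one, mul_one,
    Real.norm_of_nonneg (by linarith)] at hnorm
  linarith

end Counterexample

end DelaySystem

/-! ### The main theorem -/

theorem theorem2 (n m p : ℕ) (hn : 0 < n) (hm : 0 < m) (hp : 0 < p)
    (θ : Fin p → ℝ) (hθ_pos : ∀ k, 0 < θ k) (hθ_mono : StrictMono θ) :
    (∀ f : DelaySystem.Field n m p, Continuous f →
      (∀ K : Set (DelaySystem.Vec m), IsCompact K → DelaySystem.LocLipschitzUniformlyOn f K) →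
      [ DelaySystem.TDSForwardComplete f θ (DelaySystem.stateLinf n θ),
        DelaySystem.TDSBoundedReach f θ (DelaySystem.stateLinf n θ) (DelaySystem.normLinf θ),
        DelaySystem.TDSBoundedReach f θ (DelaySystem.stateC0 n θ) (DelaySystem.normC0 θ),
        DelaySystem.ODEForwardComplete f (DelaySystem.delayInputsLinf n p),
        DelaySystem.ODEBoundedReach f (DelaySystem.delayInputsLinf n p),
        DelaySystem.ODEBoundedReach f (DelaySystem.delayInputsC0 n p) ].TFAE ∧
      (DelaySystem.TDSForwardComplete f θ (DelaySystem.stateC0 n θ) ↔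
        DelaySystem.ODEForwardComplete f (DelaySystem.delayInputsC0 n p)) ∧
      (DelaySystem.TDSForwardComplete f θ (DelaySystem.stateLinf n θ) →
        DelaySystem.TDSForwardComplete f θ (DelaySystem.stateC0 n θ))) ∧
    (∃ f : DelaySystem.Field n m p, Continuous f ∧
      DelaySystem.LocLipschitzUniformlyOn f Set.univ ∧
      DelaySystem.TDSForwardComplete f θ (DelaySystem.stateC0 n θ) ∧
      DelaySystem.ODEForwardComplete f (DelaySystem.delayInputsC0 n p) ∧
      ¬ DelaySystem.TDSForwardComplete f θ (DelaySystem.stateLinf n θ) ∧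
      ¬ DelaySystem.TDSBoundedReach f θ (DelaySystem.stateLinf n θ) (DelaySystem.normLinf θ) ∧
      ¬ DelaySystem.TDSBoundedReach f θ (DelaySystem.stateC0 n θ) (DelaySystem.normC0 θ) ∧
      ¬ DelaySystem.ODEForwardComplete f (DelaySystem.delayInputsLinf n p) ∧
      ¬ DelaySystem.ODEBoundedReach f (DelaySystem.delayInputsLinf n p) ∧
      ¬ DelaySystem.ODEBoundedReach f (DelaySystem.delayInputsC0 n p)) := by
  open DelaySystem in
  refine ⟨fun f hf hK => ?_, ?_⟩
  · have hL := LocLipschitzUniformlyOn.lipOnBalls hf hK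
    exact ⟨tfae_forwardComplete_boundedReach hf hL hθ_pos hθ_mono.injective,
      tdsForwardComplete_c0_iff hf hL hθ_pos hθ_mono.injective,
      fun h => h.mono stateC0_subset_stateLinf⟩
  · have hc : Continuous (resonantField m (⟨0, hn⟩ : Fin n) (⟨0, hp⟩ : Fin p)) :=
      continuous_resonantField
    have htfae := tfae_forwardComplete_boundedReach hc lipOnBalls_resonantField hθ_pos
      hθ_mono.injective
    have hnot := not_odeForwardComplete_linf_resonantField (m := m) (i := (⟨0, hn⟩ : Fin n))
      (k := (⟨0, hp⟩ : Fin p))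
    have hFC := odeForwardComplete_c0_resonantField (m := m) (i := (⟨0, hn⟩ : Fin n))
      (k := (⟨0, hp⟩ : Fin p))
    exact ⟨_, hc, locLipschitzUniformlyOn_resonantField,
      (tdsForwardComplete_c0_iff hc lipOnBalls_resonantField hθ_pos hθ_mono.injective).2 hFC, hFC,
      fun h => hnot ((htfae.out 0 3).1 h), fun h => hnot ((htfae.out 1 3).1 h),
      fun h => hnot ((htfae.out 2 3).1 h), hnot, fun h => hnot ((htfae.out 4 3).1 h),
      fun h => hnot ((htfae.out 5 3).1 h)⟩
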